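/- Let $1<p<\infty$ and $\frac1p+\frac1q=1$. Write $\mathbb D$ for the open unit disc and $\mathbb T$ for the unit circle; functions analytic in $\mathbb D$ are identified on $\mathbb T$ with their (radial) boundary values, where these exist. Let $I$ be an inner function, that is, a bounded analytic function in $\mathbb D$ with $|I|=1$ a.e. on $\mathbb T$, and let $\sigma(I)=\{\lambda\in\overline{\mathbb D}:\liminf_{z\to\lambda,\,z\in\mathbb D}|I(z)|=0\}$ be its spectrum. Let $H^p$ be the Hardy space of $\mathbb D$, and for an outer function $g\in H^p$ let $H^p(|g|^p)$ be the space of all $f$ analytic in $\mathbb D$ with $\sup_{0<r<1}\frac1{2\pi}\int_{-\pi}^{\pi}|f(re^{it})|^p|g(re^{it})|^p\,dt<\infty$; let $H^p_0$ and $H^p_0(|g|^p)$ be the subspaces of functions vanishing at $0$. Set $$K^p_I=H^p\cap I\,\overline{H^p_0},\qquad K^p_I(|g|^p)=H^p(|g|^p)\cap I\,\overline{H^p_0(|g|^p)},$$ that is, $f\in H^p$ (respectively $f\in H^p(|g|^p)$) belongs to $K^p_I$ (respectively $K^p_I(|g|^p)$) if and only if there is $\psi\in H^p_0$ (respectively $\psi\in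 H^p_0(|g|^p)$) with $f=I\overline{\psi}$ a.e. on $\mathbb T$. Let $\Gamma\subset\mathbb T$ be a closed arc not meeting $\sigma(I)$, and let $g$ be an outer function in $H^p$ such that $|g|\ge\delta$ a.e. on $\mathbb T\setminus\Gamma$ for some constant $\delta>0$, and $1/g\in L^s(\Gamma)$ for some $s$ with $q<s\le\infty$. Then $K^p_I(|g|^p)\subset K^p_I$. If moreover $g$ is bounded, then $K^p_I(|g|^p)=K^p_I$. -/

import Mathlib

open MeasureTheory Filter Topology Metric Set

noncomputable section

/-- The open unit disc. Analytic functions on the disc are represented by functions `ℂ → ℂ`; every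
notion below only looks at their values in the disc. -/
abbrev unitDisc : Set ℂ := ball (0 : ℂ) 1

/-- `f` has the radial limit `w` at the point `ζ` of the unit circle. -/
def HasRadialLimit (f : ℂ → ℂ) (ζ w : ℂ) : Prop :=
  Tendsto (fun r : ℝ => f ((r : ℂ) * ζ)) (𝓝[<] (1 : ℝ)) (𝓝 w)

/-- The boundary function of `f` on the unit circle: its value at `ζ` is the radial limit of `f`
at `ζ` (for functions in Hardy spaces this limit exists almost everywhere). -/
def boundaryValue (f : ℂ → ℂ) (ζ : ℂ) : ℂ :=
  limUnder (𝓝[<] (1 : ℝ)) (fun r : ℝ => f ((r : ℂ) * ζ))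

/-- The Hardy space `H^p` of the disc. -/
def hardySpace (p : ℝ) : Set (ℂ → ℂ) :=
  {f | DifferentiableOn ℂ f unitDisc ∧
    ∃ C : ℝ, ∀ r : ℝ, 0 < r → r < 1 → Real.circleAverage (fun z => ‖f z‖ ^ p) 0 r ≤ C}

/-- The weighted Hardy space `H^p(|g|^p)`. -/
def weightedHardySpace (p : ℝ) (g : ℂ → ℂ) : Set (ℂ → ℂ) :=
  {f | DifferentiableOn ℂ f unitDisc ∧
    ∃ C : ℝ, ∀ r : ℝ, 0 < r → r < 1 →
      Real.circleAverage (fun z => ‖f z‖ ^ p * ‖g z‖ ^ p) 0 r ≤ C}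

/-- Inner functions: bounded analytic functions on the disc whose boundary values have modulus `1`
almost everywhere on the unit circle (`circleMap 0 1 t = exp (i t)`). -/
def IsInnerFunction (I : ℂ → ℂ) : Prop :=
  DifferentiableOn ℂ I unitDisc ∧ (∃ M : ℝ, ∀ z ∈ unitDisc, ‖I z‖ ≤ M) ∧
    ∀ᵐ t : ℝ, ∃ w : ℂ, HasRadialLimit I (circleMap 0 1 t) w ∧ ‖w‖ = 1

/-- Outer functions: `g(z) = c * exp ((1 / 2π) ∫ (ζ + z) / (ζ - z) * log φ(ζ) |dζ|)` in the disc,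
with `|c| = 1`, `φ > 0` and `log φ` integrable on the unit circle. -/
def IsOuterFunction (g : ℂ → ℂ) : Prop :=
  ∃ (c : ℂ) (φ : ℂ → ℝ), ‖c‖ = 1 ∧ (∀ ζ, 0 < φ ζ) ∧
    CircleIntegrable (fun ζ => Real.log (φ ζ)) 0 1 ∧
    ∀ z ∈ unitDisc, g z = c * Complex.exp
      (Real.circleAverage (fun ζ => herglotzRieszKernel 0 z ζ * (Real.log (φ ζ) : ℂ)) 0 1)

/-- The boundary relation `f = I * conj ψ` almost everywhere on the unit circle. -/
def BoundaryFactor (f I ψ : ℂ → ℂ) : Prop :=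
  ∀ᵐ t : ℝ, ∃ a b w : ℂ, HasRadialLimit f (circleMap 0 1 t) a ∧
    HasRadialLimit I (circleMap 0 1 t) b ∧ HasRadialLimit ψ (circleMap 0 1 t) w ∧
    a = b * (starRingEnd ℂ) w

/-- The backward shift invariant subspace `K^p_I`: the functions `f` in `H^p` that equal
`I * conj ψ` on the unit circle for some `ψ` in `H^p` with `ψ 0 = 0`. -/
def modelSpace (p : ℝ) (I : ℂ → ℂ) : Set (ℂ → ℂ) :=
  {f | f ∈ hardySpace p ∧ ∃ ψ ∈ hardySpace p, ψ 0 = 0 ∧ BoundaryFactor f I ψ}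

/-- The weighted space `K^p_I(|g|^p)`: the functions `f` in `H^p(|g|^p)` that equal
`I * conj ψ` on the unit circle for some `ψ` in `H^p(|g|^p)` with `ψ 0 = 0`. -/
def weightedModelSpace (p : ℝ) (I g : ℂ → ℂ) : Set (ℂ → ℂ) :=
  {f | f ∈ weightedHardySpace p g ∧
    ∃ ψ ∈ weightedHardySpace p g, ψ 0 = 0 ∧ BoundaryFactor f I ψ}

/-- The spectrum of `I`: the points `l` of the closed disc with `liminf |I(z)| = 0` as `z → l`
within the disc. -/
def innerSpectrum (I : ℂ → ℂ) : Set ℂ :=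
  {l | l ∈ closedBall (0 : ℂ) 1 ∧ liminf (fun z => ‖I z‖ₑ) (𝓝[unitDisc] l) = 0}

/-- Closed arcs of the unit circle. -/
def IsClosedArc (Γ : Set ℂ) : Prop :=
  ∃ a b : ℝ, a ≤ b ∧ Γ = circleMap 0 1 '' Icc a b

/-- `u` belongs to `L^s(Γ)` with respect to arc length on the unit circle. -/
def MemLpOnArc (u : ℂ → ℂ) (s : ENNReal) (Γ : Set ℂ) : Prop :=
  MemLp (fun t : ℝ => u (circleMap 0 1 t)) s
    (volume.restrict (Ioc 0 (2 * Real.pi) ∩ circleMap 0 1 ⁻¹' Γ))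

end

/-!
Let `f` and `ψ` be in `H^p(|g|^p)` with `f = I * conj ψ` on the circle and `ψ 0 = 0`. The proof that
`f` and `ψ` are in `H^p` has two halves, one global and one local.

*Global.* The hypotheses on `g` say that `1/g` is in `L^s` of the circle for some `s > q`. As `g` is
outer, Jensen's inequality for Poisson integrals puts `1/g` in `H^s` (`lintegral_inv_outer_le`).
Then `f = (f g) * (1/g)` is in `H^r` with `1/r = 1/p + 1/s < 1` by Hölder's inequality
(`mem_hardySpace_of_mem_weighted`), and likewise `ψ`. Since `r > 1`, both functions are the Poisson
and the Cauchy integrals of their boundary values, and by Smirnov's theorem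
(`mem_hardySpace_of_lintegral_boundaryValue`) it suffices that these boundary values are in `L^p`.
For `ψ` this follows from the statement for `f`, because `|ψ| = |f|` on the circle. Off `Γ` it is
clear, because there `|f| ≤ |f g| / δ` with `f g` in `H^p`.

*Local.* On `Γ` the function `f` is bounded. The Cauchy integral of `conj ψ` vanishes, so that
`f z = ∫ ζ / (ζ - z) * (I ζ - I z) * conj (ψ ζ)`, and `f` is bounded near a point `ζ₀` of the circle
as soon as `|I ζ - I z| ≤ C |ζ - z|` for `z` near `ζ₀` (`exists_bound_near`). Such an estimate holds
off the spectrum: in the coordinate `w = -i log (z / ζ₀)` the function `I`, and its reflection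
`1 / conj I` in the real axis, are bounded on the two halves of a square, with boundary values on
the axis that agree almost everywhere because `|I| = 1`. Cauchy's formula along the boundary of the
square holds as if the axis were not there, and gives the Lipschitz condition
(`norm_sub_le_of_boundaryValues_agree`).

The hypotheses on `g` concern its radial limits, and for these one needs Fatou's theorem for Poisson
integrals (`ae_tendsto_integral_poissonMeasure`), the existence of radial limits of functions in
`H²`, and the fact that `|g| = φ` almost everywhere on the circle, where `φ` is the function that
defines the outer function `g` (`ae_hasRadialLimit_outer`).
-/

/-! ### The normalized arc length measure and Poisson measures -/

/-- Normalized arc length on the circle, as a probability measure on the interval of angles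
`(0, 2π]`. -/
noncomputable def circleProb : Measure ℝ :=
  (ENNReal.ofReal (2 * Real.pi))⁻¹ • volume.restrict (Ioc 0 (2 * Real.pi))

instance isProbabilityMeasure_circleProb : IsProbabilityMeasure circleProb := by
  constructor
  have h : ENNReal.ofReal (2 * Real.pi) ≠ 0 := by simp [Real.pi_pos]
  simp only [circleProb, Measure.smul_apply, Measure.restrict_apply MeasurableSet.univ,
    Set.univ_inter, Real.volume_Ioc, sub_zero, smul_eq_mul]
  exact ENNReal.inv_mul_cancel h ENNReal.ofReal_ne_top

theorem ae_circleProb {P : ℝ → Prop} (h : ∀ᵐ t : ℝ, P t) : ∀ᵐ t ∂circleProb, P t :=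
  Measure.ae_smul_measure (ae_restrict_of_ae h) _

theorem circleAverage_eq_integral_circleProb {F : Type*} [NormedAddCommGroup F] [NormedSpace ℝ F]
    (f : ℂ → F) (c : ℂ) (R : ℝ) :
    Real.circleAverage f c R = ∫ t, f (circleMap c R t) ∂circleProb := by
  rw [Real.circleAverage_def, circleProb, integral_smul_measure,
    intervalIntegral.integral_of_le Real.two_pi_pos.le, ENNReal.toReal_inv,
    ENNReal.toReal_ofReal Real.two_pi_pos.le]

theorem circleIntegrable_iff_integrable_circleProb {F : Type*} [NormedAddCommGroup F]
    (f : ℂ → F) (c : ℂ) (R : ℝ) :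
    CircleIntegrable f c R ↔ Integrable (fun t => f (circleMap c R t)) circleProb := by
  rw [CircleIntegrable, intervalIntegrable_iff, uIoc_of_le Real.two_pi_pos.le, IntegrableOn,
    circleProb, integrable_smul_measure (ENNReal.inv_ne_zero.2 ENNReal.ofReal_ne_top)
      (by simp [Real.pi_pos])]

theorem norm_circleMap_zero_one (t : ℝ) : ‖circleMap 0 1 t‖ = 1 := by simp

theorem circleMap_zero_eq_mul (ρ t : ℝ) : circleMap 0 ρ t = (ρ : ℂ) * circleMap 0 1 t := by
  simp [circleMap]

theorem real_mul_mem_unitDisc {ρ : ℝ} (h0 : 0 < ρ) (h1 : ρ < 1) {z : ℂ} (hz : ‖z‖ ≤ 1) :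
    (ρ : ℂ) * z ∈ unitDisc := by
  simp only [unitDisc, mem_ball, dist_zero_right, norm_mul, Complex.norm_real, Real.norm_eq_abs,
    abs_of_pos h0]
  nlinarith [norm_nonneg z]

theorem tendsto_real_mul (z : ℂ) : Tendsto (fun r : ℝ => (r : ℂ) * z) (𝓝[<] 1) (𝓝 z) := by
  have h : Continuous fun r : ℝ => (r : ℂ) * z := by fun_prop
  have h1 := h.tendsto 1
  rw [Complex.ofReal_one, one_mul] at h1
  exact h1.mono_left nhdsWithin_le_nhds

theorem eventually_real_mul_circleMap_mem (t : ℝ) :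
    ∀ᶠ r : ℝ in 𝓝[<] 1, (r : ℂ) * circleMap 0 1 t ∈ unitDisc := by
  filter_upwards [Ioo_mem_nhdsLT zero_lt_one] with r hr
  exact real_mul_mem_unitDisc hr.1 hr.2 (norm_circleMap_zero_one t).le

theorem circleMap_mem_unitDisc {ρ : ℝ} (h0 : 0 < ρ) (h1 : ρ < 1) (t : ℝ) :
    circleMap 0 ρ t ∈ unitDisc := by
  rw [circleMap_zero_eq_mul]
  exact real_mul_mem_unitDisc h0 h1 (norm_circleMap_zero_one t).le

theorem continuous_comp_circleMap {F : Type*} [TopologicalSpace F] {f : ℂ → F}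
    (hf : ContinuousOn f unitDisc) {ρ : ℝ} (h0 : 0 < ρ) (h1 : ρ < 1) :
    Continuous (fun t => f (circleMap 0 ρ t)) :=
  hf.comp_continuous (continuous_circleMap 0 ρ) (circleMap_mem_unitDisc h0 h1)

theorem integrable_circleProb_of_continuous {F : Type*} [NormedAddCommGroup F] {f : ℝ → F}
    (hf : Continuous f) : Integrable f circleProb := by
  have : IntegrableOn f (Ioc 0 (2 * Real.pi)) := by
    rw [← intervalIntegrable_iff_integrableOn_Ioc_of_le Real.two_pi_pos.le]
    exact hf.intervalIntegrable _ _
  exact this.smul_measure (by simp [Real.pi_pos])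

theorem ofReal_norm_rpow {F : Type*} [NormedAddCommGroup F] (x : F) {p : ℝ} (hp : 0 ≤ p) :
    ENNReal.ofReal (‖x‖ ^ p) = ‖x‖ₑ ^ p := by
  rw [← ENNReal.ofReal_rpow_of_nonneg (norm_nonneg _) hp, ofReal_norm]

/-- Membership in `H^p` in terms of `ℝ≥0∞`-valued integral means. -/
theorem mem_hardySpace_iff {p : ℝ} (hp : 0 ≤ p) {f : ℂ → ℂ} :
    f ∈ hardySpace p ↔ DifferentiableOn ℂ f unitDisc ∧
      ∃ C : ENNReal, C ≠ ⊤ ∧ ∀ ρ : ℝ, 0 < ρ → ρ < 1 →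
        ∫⁻ t, ‖f (circleMap 0 ρ t)‖ₑ ^ p ∂circleProb ≤ C := by
  refine and_congr_right fun hf => ?_
  have key : ∀ ρ : ℝ, 0 < ρ → ρ < 1 →
      ENNReal.ofReal (Real.circleAverage (fun z => ‖f z‖ ^ p) 0 ρ) =
        ∫⁻ t, ‖f (circleMap 0 ρ t)‖ₑ ^ p ∂circleProb := by
    intro ρ h0 h1
    rw [circleAverage_eq_integral_circleProb, ofReal_integral_eq_lintegral_ofReal]
    · simp_rw [ofReal_norm_rpow _ hp]
    · exact integrable_circleProb_of_continuous
        ((continuous_comp_circleMap hf.continuousOn h0 h1).norm.rpow_const fun _ => Or.inr hp)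
    · exact Eventually.of_forall fun t => by positivity
  constructor
  · rintro ⟨C, hC⟩
    refine ⟨ENNReal.ofReal C, ENNReal.ofReal_ne_top, fun ρ h0 h1 => ?_⟩
    rw [← key ρ h0 h1]
    exact ENNReal.ofReal_le_ofReal (hC ρ h0 h1)
  · rintro ⟨C, hC, h⟩
    refine ⟨C.toReal, fun ρ h0 h1 => ?_⟩
    rw [← ENNReal.ofReal_le_iff_le_toReal hC, key ρ h0 h1]
    exact h ρ h0 h1

theorem mul_mem_hardySpace_of_mem_weighted {p : ℝ} {f g : ℂ → ℂ}
    (hg : DifferentiableOn ℂ g unitDisc) (hf : f ∈ weightedHardySpace p g) :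
    (fun z => f z * g z) ∈ hardySpace p := by
  obtain ⟨hfd, C, hC⟩ := hf
  refine ⟨hfd.mul hg, C, fun r h0 h1 => ?_⟩
  have : (fun z => ‖f z * g z‖ ^ p) = fun z => ‖f z‖ ^ p * ‖g z‖ ^ p := by
    funext z
    rw [norm_mul, Real.mul_rpow (norm_nonneg _) (norm_nonneg _)]
  rw [this]
  exact hC r h0 h1

/-- The Poisson measure at `z`: normalized arc length weighted by the Poisson kernel of `z`. It is
harmonic measure of the disc, seen from `z`. -/
noncomputable def poissonMeasure (z : ℂ) : Measure ℝ :=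
  circleProb.withDensity fun t => ENNReal.ofReal (poissonKernel 0 z (circleMap 0 1 t))

theorem poissonKernel_circle (z : ℂ) (t : ℝ) :
    poissonKernel 0 z (circleMap 0 1 t) = (1 - ‖z‖ ^ 2) / ‖circleMap 0 1 t - z‖ ^ 2 := by
  simp [poissonKernel_def]

theorem circleMap_sub_ne_zero {z : ℂ} (hz : z ∈ unitDisc) (t : ℝ) : circleMap 0 1 t - z ≠ 0 := by
  rw [sub_ne_zero]
  rintro rfl
  simp [unitDisc] at hz

theorem norm_lt_one_of_mem_unitDisc {z : ℂ} (hz : z ∈ unitDisc) : ‖z‖ < 1 := by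
  simpa [unitDisc] using hz

theorem poissonKernel_nonneg {z : ℂ} (hz : z ∈ unitDisc) (t : ℝ) :
    0 ≤ poissonKernel 0 z (circleMap 0 1 t) := by
  rw [poissonKernel_circle]
  have := norm_lt_one_of_mem_unitDisc hz
  have : 0 ≤ 1 - ‖z‖ ^ 2 := by nlinarith [norm_nonneg z]
  positivity

theorem continuous_poissonKernel {z : ℂ} (hz : z ∈ unitDisc) :
    Continuous fun t => poissonKernel 0 z (circleMap 0 1 t) := by
  simp_rw [poissonKernel_circle]
  refine Continuous.div (by fun_prop) (by fun_prop) fun t => ?_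
  exact pow_ne_zero _ (norm_ne_zero_iff.2 (circleMap_sub_ne_zero hz t))

theorem poissonKernel_le {z : ℂ} (hz : z ∈ unitDisc) (t : ℝ) :
    poissonKernel 0 z (circleMap 0 1 t) ≤ 1 / (1 - ‖z‖) ^ 2 := by
  have h1 := norm_lt_one_of_mem_unitDisc hz
  rw [poissonKernel_circle]
  have h2 : 1 - ‖z‖ ≤ ‖circleMap 0 1 t - z‖ := by
    have := norm_sub_norm_le (circleMap 0 1 t) z
    rwa [norm_circleMap_zero_one] at this
  have h3 : 0 < 1 - ‖z‖ := by linarith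
  exact div_le_div₀ zero_le_one (by nlinarith [sq_nonneg ‖z‖]) (by positivity)
    (pow_le_pow_left₀ h3.le h2 2)

theorem integral_poissonMeasure {F : Type*} [NormedAddCommGroup F] [NormedSpace ℝ F]
    {z : ℂ} (hz : z ∈ unitDisc) (f : ℝ → F) :
    ∫ t, f t ∂poissonMeasure z =
      ∫ t, poissonKernel 0 z (circleMap 0 1 t) • f t ∂circleProb := by
  rw [poissonMeasure, integral_withDensity_eq_integral_toReal_smul
    (continuous_poissonKernel hz).measurable.ennreal_ofReal (by simp)]
  simp_rw [ENNReal.toReal_ofReal (poissonKernel_nonneg hz _)]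

theorem poissonMeasure_le {z : ℂ} (hz : z ∈ unitDisc) :
    poissonMeasure z ≤ ENNReal.ofReal (1 / (1 - ‖z‖) ^ 2) • circleProb := by
  rw [poissonMeasure, ← withDensity_const]
  exact withDensity_mono (Eventually.of_forall fun t =>
    ENNReal.ofReal_le_ofReal (poissonKernel_le hz t))

theorem integrable_poissonMeasure {F : Type*} [NormedAddCommGroup F] {z : ℂ} (hz : z ∈ unitDisc)
    {f : ℝ → F} (hf : Integrable f circleProb) : Integrable f (poissonMeasure z) :=
  (hf.smul_measure ENNReal.ofReal_ne_top).mono_measure (poissonMeasure_le hz)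

theorem diffContOnCl_dilate {f : ℂ → ℂ} (hf : DifferentiableOn ℂ f unitDisc) {ρ : ℝ}
    (h0 : 0 < ρ) (h1 : ρ < 1) : DiffContOnCl ℂ (fun w => f ((ρ : ℂ) * w)) (ball 0 1) := by
  refine DifferentiableOn.diffContOnCl ?_
  rw [closure_ball _ one_ne_zero]
  refine hf.comp (by fun_prop) fun w hw => ?_
  exact real_mul_mem_unitDisc h0 h1 (by simpa using hw)

/-- Poisson's formula for the dilates of a function analytic in the disc. -/
theorem integral_dilate_poissonMeasure {f : ℂ → ℂ} (hf : DifferentiableOn ℂ f unitDisc) {ρ : ℝ}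
    (h0 : 0 < ρ) (h1 : ρ < 1) {z : ℂ} (hz : z ∈ unitDisc) :
    ∫ t, f (circleMap 0 ρ t) ∂poissonMeasure z = f (ρ * z) := by
  have := (diffContOnCl_dilate hf h0 h1).circleAverage_poissonKernel_smul hz
  rw [circleAverage_eq_integral_circleProb] at this
  rw [integral_poissonMeasure hz, ← this]
  simp_rw [circleMap_zero_eq_mul ρ]
  rfl

theorem integral_poissonKernel {z : ℂ} (hz : z ∈ unitDisc) :
    ∫ t, poissonKernel 0 z (circleMap 0 1 t) ∂circleProb = 1 := by
  have := integral_dilate_poissonMeasure (differentiableOn_const (1 : ℂ)) (ρ := 1 / 2)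
    (by norm_num) (by norm_num) hz
  rw [integral_poissonMeasure hz] at this
  simp only [Complex.real_smul, mul_one] at this
  rw [integral_complex_ofReal] at this
  exact_mod_cast this

theorem isProbabilityMeasure_poissonMeasure {z : ℂ} (hz : z ∈ unitDisc) :
    IsProbabilityMeasure (poissonMeasure z) := by
  constructor
  rw [poissonMeasure, withDensity_apply _ MeasurableSet.univ, Measure.restrict_univ,
    ← ofReal_integral_eq_lintegral_ofReal, integral_poissonKernel hz, ENNReal.ofReal_one]
  · exact integrable_circleProb_of_continuous (continuous_poissonKernel hz)
  · exact Eventually.of_forall (poissonKernel_nonneg hz)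

theorem norm_circleMap_sub_comm (ρ t x : ℝ) :
    ‖circleMap 0 1 x - circleMap 0 ρ t‖ = ‖circleMap 0 1 t - circleMap 0 ρ x‖ := by
  rw [← sq_eq_sq₀ (norm_nonneg _) (norm_nonneg _), ← Complex.normSq_eq_norm_sq,
    ← Complex.normSq_eq_norm_sq]
  simp only [circleMap, zero_add, Complex.exp_mul_I, Complex.normSq_apply, Complex.sub_re,
    Complex.sub_im, Complex.mul_re, Complex.mul_im, Complex.add_re, Complex.add_im,
    Complex.ofReal_re, Complex.ofReal_im, Complex.I_re, Complex.I_im, Complex.cos_ofReal_re,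
    Complex.sin_ofReal_re, Complex.cos_ofReal_im, Complex.sin_ofReal_im]
  have h1 := Real.sin_sq_add_cos_sq x
  have h2 := Real.sin_sq_add_cos_sq t
  linear_combination (1 - ρ ^ 2) * h1 - (1 - ρ ^ 2) * h2

theorem poissonKernel_symm (ρ t x : ℝ) :
    poissonKernel 0 (circleMap 0 ρ t) (circleMap 0 1 x) =
      poissonKernel 0 (circleMap 0 ρ x) (circleMap 0 1 t) := by
  rw [poissonKernel_circle, poissonKernel_circle, norm_circleMap_sub_comm]
  simp

theorem lintegral_poissonMeasure {z : ℂ} (hz : z ∈ unitDisc) {Φ : ℝ → ENNReal}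
    (hΦ : AEMeasurable Φ circleProb) :
    ∫⁻ x, Φ x ∂poissonMeasure z =
      ∫⁻ x, ENNReal.ofReal (poissonKernel 0 z (circleMap 0 1 x)) * Φ x ∂circleProb :=
  lintegral_withDensity_eq_lintegral_mul₀
    (continuous_poissonKernel hz).measurable.ennreal_ofReal.aemeasurable hΦ

theorem lintegral_poissonKernel {z : ℂ} (hz : z ∈ unitDisc) :
    ∫⁻ x, ENNReal.ofReal (poissonKernel 0 z (circleMap 0 1 x)) ∂circleProb = 1 := by
  have h := (isProbabilityMeasure_poissonMeasure hz).measure_univ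
  rwa [poissonMeasure, withDensity_apply _ MeasurableSet.univ, Measure.restrict_univ] at h

/-- The mean over a circle of a Poisson integral is the mean of the boundary function. -/
theorem lintegral_lintegral_poissonMeasure {Φ : ℝ → ENNReal} (hΦ : AEMeasurable Φ circleProb)
    {ρ : ℝ} (h0 : 0 < ρ) (h1 : ρ < 1) :
    ∫⁻ t, ∫⁻ x, Φ x ∂poissonMeasure (circleMap 0 ρ t) ∂circleProb = ∫⁻ x, Φ x ∂circleProb := by
  have hP : Continuous (Function.uncurry fun t x : ℝ =>
      poissonKernel 0 (circleMap 0 ρ t) (circleMap 0 1 x)) := by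
    simp only [Function.uncurry_def, poissonKernel_circle]
    refine Continuous.div (by fun_prop) (by fun_prop) fun t => ?_
    exact pow_ne_zero _ (norm_ne_zero_iff.2
      (circleMap_sub_ne_zero (circleMap_mem_unitDisc h0 h1 _) _))
  have hP' : Measurable (Function.uncurry fun t x : ℝ =>
      ENNReal.ofReal (poissonKernel 0 (circleMap 0 ρ t) (circleMap 0 1 x))) :=
    hP.measurable.ennreal_ofReal
  rw [lintegral_congr fun t => lintegral_poissonMeasure (circleMap_mem_unitDisc h0 h1 t) hΦ,
    lintegral_lintegral_swap (hP'.aemeasurable.mul hΦ.comp_snd)]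
  refine lintegral_congr fun x => ?_
  rw [lintegral_congr fun t => by rw [poissonKernel_symm ρ t x]]
  rw [lintegral_mul_const _
    (continuous_poissonKernel (circleMap_mem_unitDisc h0 h1 x)).measurable.ennreal_ofReal,
    lintegral_poissonKernel (circleMap_mem_unitDisc h0 h1 x), one_mul]

/-- Cauchy's formula for the dilates of a function analytic in the disc. -/
theorem integral_dilate_cauchy {f : ℂ → ℂ} (hf : DifferentiableOn ℂ f unitDisc) {ρ : ℝ}
    (h0 : 0 < ρ) (h1 : ρ < 1) {z : ℂ} (hz : z ∈ unitDisc) :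
    ∫ t, circleMap 0 1 t / (circleMap 0 1 t - z) * f (circleMap 0 ρ t) ∂circleProb =
      f (ρ * z) := by
  have hd := diffContOnCl_dilate hf h0 h1
  rw [← abs_one (α := ℝ)] at hd
  have := hd.circleAverage_smul_div (w := z) (by simpa using hz)
  rw [circleAverage_eq_integral_circleProb] at this
  rw [← this]
  simp_rw [circleMap_zero_eq_mul ρ, sub_zero, smul_eq_mul]

/-- The Cauchy integral of a conjugate-analytic function is constant. -/
theorem integral_dilate_conj_cauchy {f : ℂ → ℂ} (hf : DifferentiableOn ℂ f unitDisc) {ρ : ℝ}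
    (h0 : 0 < ρ) (h1 : ρ < 1) {z : ℂ} (hz : z ∈ unitDisc) :
    ∫ t, circleMap 0 1 t / (circleMap 0 1 t - z) *
      (starRingEnd ℂ) (f (circleMap 0 ρ t)) ∂circleProb = (starRingEnd ℂ) (f 0) := by
  have hz1 := norm_lt_one_of_mem_unitDisc hz
  have hne : ∀ w ∈ closedBall (0 : ℂ) 1, 1 - (starRingEnd ℂ) z * w ≠ 0 := by
    intro w hw h
    have h2 : ‖(starRingEnd ℂ) z * w‖ = 1 := by
      rw [← sub_eq_zero.1 h, norm_one]
    rw [norm_mul, RCLike.norm_conj] at h2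
    have : ‖w‖ ≤ 1 := by simpa using hw
    nlinarith [norm_nonneg z]
  have hd : DiffContOnCl ℂ (fun w => (1 - (starRingEnd ℂ) z * w)⁻¹ * f (ρ * w)) (ball 0 1) := by
    have hd1 : DiffContOnCl ℂ (fun w => (1 - (starRingEnd ℂ) z * w)⁻¹) (ball 0 1) := by
      refine DifferentiableOn.diffContOnCl ?_
      rw [closure_ball _ one_ne_zero]
      exact DifferentiableOn.inv (by fun_prop) hne
    exact hd1.smul (diffContOnCl_dilate hf h0 h1)
  rw [← abs_one (α := ℝ)] at hd
  have := hd.circleAverage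
  rw [circleAverage_eq_integral_circleProb] at this
  simp only [mul_zero, sub_zero, inv_one, one_mul] at this
  rw [← this, ← integral_conj]
  refine integral_congr_ae (Eventually.of_forall fun t => ?_)
  have h3 : circleMap 0 1 t * (starRingEnd ℂ) (circleMap 0 1 t) = 1 := by
    rw [Complex.mul_conj, Complex.normSq_eq_norm_sq]
    simp
  have h4 := circleMap_sub_ne_zero hz t
  have h5 : circleMap 0 1 t / (circleMap 0 1 t - z) =
      (1 - z * (starRingEnd ℂ) (circleMap 0 1 t))⁻¹ := by
    rw [div_eq_iff h4, eq_comm, inv_mul_eq_iff_eq_mul₀]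
    · linear_combination z * h3
    · intro h
      apply h4
      linear_combination z * h3 + circleMap 0 1 t * h
  simp [h5, circleMap_zero_eq_mul ρ]

/-! ### Radial limits of Poisson integrals -/

theorem lintegral_Ioi_layer {v : ℝ} (hv : 0 ≤ v) :
    ∫⁻ u in Ioi v, ENNReal.ofReal (2 * u / (1 + u ^ 2) ^ 2) = ENNReal.ofReal (1 / (1 + v ^ 2)) := by
  have hd : ∀ x ∈ Ioi v, HasDerivAt (fun u : ℝ => -(1 + u ^ 2)⁻¹) (2 * x / (1 + x ^ 2) ^ 2) x := by
    intro x _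
    have h1 : HasDerivAt (fun u : ℝ => 1 + u ^ 2) (2 * x) x := by
      simpa using (hasDerivAt_pow 2 x).const_add 1
    have h2 := (h1.fun_inv (by positivity)).neg
    rwa [neg_div, neg_neg] at h2
  have hc : ContinuousWithinAt (fun u : ℝ => -(1 + u ^ 2)⁻¹) (Ici v) v := by
    refine Continuous.continuousWithinAt ?_
    exact ((by fun_prop : Continuous fun u : ℝ => 1 + u ^ 2).inv₀ fun u => by positivity).neg
  have hp : ∀ x ∈ Ioi v, 0 ≤ 2 * x / (1 + x ^ 2) ^ 2 := by
    intro x hx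
    have : 0 ≤ x := hv.trans (le_of_lt hx)
    positivity
  have hl : Tendsto (fun u : ℝ => -(1 + u ^ 2)⁻¹) atTop (𝓝 0) := by
    have : Tendsto (fun u : ℝ => 1 + u ^ 2) atTop atTop :=
      tendsto_atTop_add_const_left _ _ (tendsto_pow_atTop two_ne_zero)
    simpa using this.inv_tendsto_atTop.neg
  rw [← ofReal_integral_eq_lintegral_ofReal (integrableOn_Ioi_deriv_of_nonneg hc hd hp hl)
    ((ae_restrict_iff' measurableSet_Ioi).2 (Eventually.of_forall hp)),
    integral_Ioi_of_hasDerivAt_of_nonneg hc hd hp hl]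
  congr 1
  simp

/-- The kernel `h / (h² + y²)` is a superposition of normalized indicators of intervals centred at
the origin, so its integral against `G` is one of the centred means of `G`. -/
theorem lintegral_mul_cauchyKernel {G : ℝ → ENNReal} (hG : Measurable G) {h : ℝ} (hh : 0 < h) :
    ∫⁻ y, G y * ENNReal.ofReal (h / (h ^ 2 + y ^ 2)) =
      ∫⁻ u in Ioi 0, ENNReal.ofReal (2 * u / (1 + u ^ 2) ^ 2) *
        (ENNReal.ofReal h⁻¹ * ∫⁻ y in ball 0 (h * u), G y) := by
  set w : ℝ → ENNReal := fun u => ENNReal.ofReal (2 * u / (1 + u ^ 2) ^ 2) with hw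
  have hwm : Measurable w := by fun_prop
  set S : Set (ℝ × ℝ) := {q | |q.1| / h < q.2} with hS
  have hSm : MeasurableSet S := measurableSet_lt (by fun_prop) (by fun_prop)
  have h1 : ∀ y : ℝ, G y * ENNReal.ofReal (h / (h ^ 2 + y ^ 2)) =
      ∫⁻ u in Ioi 0, S.indicator (fun q => G q.1 * (ENNReal.ofReal h⁻¹ * w q.2)) (y, u) := by
    intro y
    have h2 : h / (h ^ 2 + y ^ 2) = h⁻¹ * (1 / (1 + (|y| / h) ^ 2)) := by
      rw [div_pow, sq_abs]
      field_simp
    have h0 : 0 ≤ |y| / h := by positivity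
    rw [h2, ENNReal.ofReal_mul (by positivity), ← lintegral_Ioi_layer h0]
    have h3 : ∀ u, S.indicator (fun q => G q.1 * (ENNReal.ofReal h⁻¹ * w q.2)) (y, u) =
        (Ioi (|y| / h)).indicator (fun u => G y * (ENNReal.ofReal h⁻¹ * w u)) u := by
      intro u
      simp only [Set.indicator, hS, mem_ofPred_eq, mem_Ioi]
    simp_rw [h3]
    rw [lintegral_indicator measurableSet_Ioi, Measure.restrict_restrict measurableSet_Ioi,
      Ioi_inter_Ioi, max_eq_left h0, lintegral_const_mul _ (by fun_prop),
      lintegral_const_mul _ hwm]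
  simp_rw [h1]
  have hm : Measurable (S.indicator (fun q => G q.1 * (ENNReal.ofReal h⁻¹ * w q.2))) := by
    refine Measurable.indicator ?_ hSm
    fun_prop
  rw [lintegral_lintegral_swap (f := fun y u =>
    S.indicator (fun q => G q.1 * (ENNReal.ofReal h⁻¹ * w q.2)) (y, u)) hm.aemeasurable]
  refine lintegral_congr fun u => ?_
  have h4 : ∀ y, S.indicator (fun q => G q.1 * (ENNReal.ofReal h⁻¹ * w q.2)) (y, u) =
      (ball 0 (h * u)).indicator (fun y => (ENNReal.ofReal h⁻¹ * w u) * G y) y := by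
    intro y
    have : |y| / h < u ↔ |y| < h * u := by rw [div_lt_iff₀ hh, mul_comm]
    simp only [Set.indicator, hS, mem_ofPred_eq, mem_ball, dist_zero_right, Real.norm_eq_abs, this]
    split_ifs
    · ring
    · rfl
  simp_rw [h4]
  rw [lintegral_indicator measurableSet_ball, lintegral_const_mul _ hG]
  ring

/-- If the origin is a Lebesgue point of `G` with value `0`, then the integrals of `G` against
`h / (h² + y²)` tend to `0`. -/
theorem tendsto_lintegral_mul_cauchyKernel {G : ℝ → ENNReal} (hG : Measurable G)
    (hfin : ∫⁻ y, G y ≠ ⊤)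
    (hleb : Tendsto (fun x => ENNReal.ofReal x⁻¹ * ∫⁻ y in ball 0 x, G y) (𝓝[>] (0 : ℝ)) (𝓝 0)) :
    Tendsto (fun h => ∫⁻ y, G y * ENNReal.ofReal (h / (h ^ 2 + y ^ 2))) (𝓝[>] 0) (𝓝 0) := by
  -- the centred means of `G` are bounded
  obtain ⟨η, hη, hηle⟩ : ∃ η : ℝ, 0 < η ∧ ∀ x ∈ Ioo 0 η,
      ENNReal.ofReal x⁻¹ * ∫⁻ y in ball 0 x, G y ≤ 1 := by
    have := hleb.eventually (ge_mem_nhds (zero_lt_one (α := ENNReal)))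
    rw [eventually_nhdsWithin_iff, Metric.eventually_nhds_iff] at this
    obtain ⟨η, hη, h⟩ := this
    refine ⟨η, hη, fun x hx => h ?_ hx.1⟩
    rw [dist_zero_right, Real.norm_eq_abs, abs_of_pos hx.1]
    exact hx.2
  set C : ENNReal := 1 + ENNReal.ofReal η⁻¹ * ∫⁻ y, G y with hC
  have hCtop : C ≠ ⊤ := by finiteness
  have hbd : ∀ x, 0 < x → ENNReal.ofReal x⁻¹ * ∫⁻ y in ball 0 x, G y ≤ C := by
    intro x hx
    rcases lt_or_ge x η with h | h
    · exact (hηle x ⟨hx, h⟩).trans le_self_add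
    · refine le_trans ?_ le_add_self
      gcongr
      exact Measure.restrict_le_self
  have hscale : ∀ h u : ℝ, 0 < h → 0 < u → ENNReal.ofReal h⁻¹ * ∫⁻ y in ball 0 (h * u), G y =
      ENNReal.ofReal u * (ENNReal.ofReal (h * u)⁻¹ * ∫⁻ y in ball 0 (h * u), G y) := by
    intro h u hh hu
    rw [← mul_assoc, ← ENNReal.ofReal_mul hu.le]
    congr 2
    field_simp
  have hkey : Tendsto (fun h : ℝ => ∫⁻ u in Ioi 0, ENNReal.ofReal (2 * u / (1 + u ^ 2) ^ 2) *
        (ENNReal.ofReal h⁻¹ * ∫⁻ y in ball 0 (h * u), G y)) (𝓝[>] 0)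
      (𝓝 (∫⁻ u in Ioi (0 : ℝ), 0)) := by
    refine tendsto_lintegral_filter_of_dominated_convergence
      (fun u => ENNReal.ofReal (2 * (1 + u ^ 2)⁻¹) * C) ?_ ?_ ?_ ?_
    · filter_upwards [self_mem_nhdsWithin] with h hh
      have : Measurable fun u : ℝ => ∫⁻ y in ball 0 (h * u), G y := by
        have h2 : ∀ u : ℝ, ∫⁻ y in ball 0 (h * u), G y =
            ∫⁻ y, {q : ℝ × ℝ | |q.2| < h * q.1}.indicator (fun q => G q.2) (u, y) := by
          intro u
          rw [← lintegral_indicator measurableSet_ball]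
          refine lintegral_congr fun y => ?_
          simp [Set.indicator]
        simp_rw [h2]
        refine Measurable.lintegral_prod_right' (f := {q : ℝ × ℝ | |q.2| < h * q.1}.indicator
          (fun q => G q.2)) ?_
        exact Measurable.indicator (by fun_prop) (measurableSet_lt (by fun_prop) (by fun_prop))
      fun_prop
    · filter_upwards [self_mem_nhdsWithin] with h hh
      refine (ae_restrict_iff' measurableSet_Ioi).2 (Eventually.of_forall fun u hu => ?_)
      have hu' : 0 < u := hu
      rw [hscale h u hh hu, ← mul_assoc, ← ENNReal.ofReal_mul (by positivity)]
      refine mul_le_mul' (ENNReal.ofReal_le_ofReal ?_) (hbd _ (mul_pos hh hu))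
      rw [div_mul_eq_mul_div, div_le_iff₀ (by positivity)]
      have : 2 * (1 + u ^ 2)⁻¹ * (1 + u ^ 2) ^ 2 = 2 * (1 + u ^ 2) := by
        field_simp
      rw [this]
      nlinarith
    · rw [lintegral_mul_const _ (by fun_prop)]
      refine ENNReal.mul_ne_top ?_ hCtop
      have hi : Integrable (fun u : ℝ => 2 * (1 + u ^ 2)⁻¹) (volume.restrict (Ioi 0)) :=
        (integrable_inv_one_add_sq.const_mul 2).integrableOn
      rw [← ofReal_integral_eq_lintegral_ofReal hi (Eventually.of_forall fun u => by positivity)]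
      exact ENNReal.ofReal_ne_top
    · refine (ae_restrict_iff' measurableSet_Ioi).2 (Eventually.of_forall fun u hu => ?_)
      have hu' : 0 < u := hu
      have h1 : Tendsto (fun h : ℝ => h * u) (𝓝[>] 0) (𝓝[>] 0) := by
        refine tendsto_nhdsWithin_iff.2 ⟨?_, ?_⟩
        · have : Tendsto (fun h : ℝ => h * u) (𝓝 0) (𝓝 (0 * u)) :=
            (continuous_id.mul continuous_const).tendsto 0
          rw [zero_mul] at this
          exact this.mono_left nhdsWithin_le_nhds
        · filter_upwards [self_mem_nhdsWithin] with h hh using mul_pos hh hu'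
      have h2 := ENNReal.Tendsto.const_mul (a := ENNReal.ofReal (2 * u / (1 + u ^ 2) ^ 2))
        (ENNReal.Tendsto.const_mul (a := ENNReal.ofReal u) (hleb.comp h1)
          (Or.inr ENNReal.ofReal_ne_top)) (Or.inr ENNReal.ofReal_ne_top)
      simp only [mul_zero] at h2
      refine h2.congr' ?_
      filter_upwards [self_mem_nhdsWithin] with h hh
      rw [hscale h u hh hu]
      rfl
  rw [lintegral_zero] at hkey
  refine hkey.congr' ?_
  filter_upwards [self_mem_nhdsWithin] with h hh
  exact (lintegral_mul_cauchyKernel hG hh).symm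

/-- Near the circle the Poisson kernel is dominated by a multiple of `h / (h² + y²)`, where `h` is
the distance to the circle. -/
theorem poissonKernel_real_le {r y : ℝ} (hr : 1 / 2 ≤ r) (hr1 : r < 1) (hy : |y| ≤ Real.pi) :
    poissonKernel 0 (r : ℂ) (circleMap 0 1 y) ≤ 10 * ((1 - r) / ((1 - r) ^ 2 + y ^ 2)) := by
  have hcos : Real.cos y ≤ 1 - 2 / Real.pi ^ 2 * y ^ 2 := Real.cos_le_one_sub_mul_cos_sq hy
  have hpi : (1 : ℝ) / 5 ≤ 2 / Real.pi ^ 2 := by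
    rw [div_le_div_iff₀ (by norm_num) (by positivity)]
    nlinarith [Real.pi_lt_d2, Real.pi_pos]
  have hn : ‖circleMap 0 1 y - r‖ ^ 2 = 1 + r ^ 2 - 2 * r * Real.cos y := by
    rw [← Complex.normSq_eq_norm_sq]
    simp only [circleMap, zero_add, Complex.exp_mul_I, Complex.normSq_apply, Complex.sub_re,
      Complex.sub_im, Complex.mul_re, Complex.mul_im, Complex.add_re, Complex.add_im,
      Complex.ofReal_re, Complex.ofReal_im, Complex.I_re, Complex.I_im, Complex.cos_ofReal_re,
      Complex.sin_ofReal_re, Complex.cos_ofReal_im, Complex.sin_ofReal_im]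
    have h1 := Real.sin_sq_add_cos_sq y
    linear_combination h1
  have hlow : (1 / 5) * ((1 - r) ^ 2 + y ^ 2) ≤ ‖circleMap 0 1 y - r‖ ^ 2 := by
    rw [hn]
    have h2 : 1 / 5 * y ^ 2 ≤ 1 - Real.cos y := by nlinarith [sq_nonneg y]
    nlinarith [sq_nonneg (1 - r), sq_nonneg y, Real.cos_le_one y]
  rw [poissonKernel_circle, Complex.norm_real, Real.norm_eq_abs, sq_abs]
  have hpos : 0 < (1 - r) ^ 2 + y ^ 2 := by nlinarith [sq_nonneg y, sub_pos.2 hr1]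
  rw [mul_div_assoc', div_le_div_iff₀ (by linarith) hpos]
  nlinarith [mul_le_mul_of_nonneg_left hlow (sub_pos.2 hr1).le,
    mul_nonneg (mul_nonneg (sub_pos.2 hr1).le hpos.le) (sub_pos.2 hr1).le]

theorem periodic_comp_circleMap {F : Type*} (h : ℂ → F) :
    Function.Periodic (fun t => h (circleMap 0 1 t)) (2 * Real.pi) := fun t => by
  simp only [periodic_circleMap 0 1 t]

theorem setLIntegral_Ioc_periodic {Q : ℝ → ENNReal} (hQ : Function.Periodic Q (2 * Real.pi))
    (t : ℝ) : ∫⁻ x in Ioc 0 (2 * Real.pi), Q x = ∫⁻ y in Ioc (-Real.pi) Real.pi, Q (t + y) := by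
  have h1 := (isAddFundamentalDomain_Ioc Real.two_pi_pos 0).setLIntegral_eq (μ := volume)
    (isAddFundamentalDomain_Ioc Real.two_pi_pos (t - Real.pi)) Q (by
      rintro ⟨g, hg⟩ x
      obtain ⟨n, rfl⟩ := AddSubgroup.mem_zmultiples_iff.1 hg
      have := (hQ.zsmul n) x
      rw [add_comm] at this
      exact this)
  rw [zero_add, show t - Real.pi + 2 * Real.pi = t + Real.pi by ring] at h1
  rw [h1, ← lintegral_indicator measurableSet_Ioc, ← lintegral_indicator measurableSet_Ioc,
    ← lintegral_add_left_eq_self _ t]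
  refine lintegral_congr fun y => ?_
  simp only [Set.indicator, mem_Ioc]
  congr 1
  exact propext ⟨fun h => ⟨by linarith [h.1], by linarith [h.2]⟩,
    fun h => ⟨by linarith [h.1], by linarith [h.2]⟩⟩

theorem locallyIntegrable_comp_circleMap {F : Type*} [NormedAddCommGroup F] {h : ℂ → F}
    (hh : CircleIntegrable h 0 1) : LocallyIntegrable (fun t => h (circleMap 0 1 t)) volume := by
  have hi : ∀ a b : ℝ, IntervalIntegrable (fun t => h (circleMap 0 1 t)) volume a b := by
    refine (periodic_comp_circleMap h).intervalIntegrable₀ Real.two_pi_pos.ne' hh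
  intro x
  refine ⟨Ioc (x - 1) (x + 1), Ioc_mem_nhds (by linarith) (by linarith), ?_⟩
  exact (intervalIntegrable_iff_integrableOn_Ioc_of_le (by linarith)).1 (hi _ _)

/-- **Fatou's theorem** for Poisson integrals: they have the boundary function as radial limit
at its Lebesgue points, so almost everywhere. -/
theorem ae_tendsto_integral_poissonMeasure {h : ℂ → ℂ} (hh : CircleIntegrable h 0 1) :
    ∀ᵐ t : ℝ, Tendsto
      (fun r : ℝ => ∫ x, h (circleMap 0 1 x) ∂poissonMeasure ((r : ℂ) * circleMap 0 1 t))
      (𝓝[<] 1) (𝓝 (h (circleMap 0 1 t))) := by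
  set L : ℝ → ℂ := fun t => h (circleMap 0 1 t) with hL
  have hLloc : LocallyIntegrable L volume := locallyIntegrable_comp_circleMap hh
  have hLint : Integrable L circleProb := (circleIntegrable_iff_integrable_circleProb h 0 1).1 hh
  filter_upwards [IsUnifLocDoublingMeasure.ae_tendsto_average_norm_sub volume hLloc 1] with t ht
  have hlim := ht (l := 𝓝[>] (0 : ℝ)) (fun _ => t) id tendsto_id (by
    filter_upwards [self_mem_nhdsWithin] with x hx
    have hx0 : (0 : ℝ) < x := hx
    simp [hx0.le])
  set G₀ : ℝ → ENNReal := (Ioc (-Real.pi) Real.pi).indicator fun y => ‖L (t + y) - L t‖ₑ with hG₀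
  have hLt : AEStronglyMeasurable (fun y => L (t + y)) volume :=
    hLloc.aestronglyMeasurable.comp_quasiMeasurePreserving
      (measurePreserving_add_left volume t).quasiMeasurePreserving
  have hG₀m : AEMeasurable G₀ :=
    (hLt.sub aestronglyMeasurable_const).enorm.indicator measurableSet_Ioc
  have hball : ∀ x : ℝ, 0 < x → ∫⁻ y in ball 0 x, G₀ y ≤
      ENNReal.ofReal (∫ y in closedBall t x, ‖L y - L t‖) := by
    intro x hx
    have hint : IntegrableOn (fun y => L y - L t) (closedBall t x) :=
      ((hLloc.integrableOn_isCompact (isCompact_closedBall t x)).sub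
        (integrableOn_const measure_closedBall_lt_top.ne (by simp)))
    rw [ofReal_integral_norm_eq_lintegral_enorm hint, ← lintegral_indicator measurableSet_ball,
      ← lintegral_indicator measurableSet_closedBall,
      ← lintegral_add_left_eq_self ((closedBall t x).indicator _) t]
    refine lintegral_mono fun y => ?_
    by_cases hy : y ∈ ball 0 x
    · have hy2 : t + y ∈ closedBall t x := by
        simp only [mem_ball, dist_zero_right] at hy
        simpa [mem_closedBall, dist_eq_norm] using hy.le
      rw [indicator_of_mem hy, indicator_of_mem hy2, hG₀]
      exact indicator_le_self _ _ _
    · rw [indicator_of_notMem hy]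
      exact zero_le
  have hleb₀ : Tendsto (fun x => ENNReal.ofReal x⁻¹ * ∫⁻ y in ball 0 x, G₀ y) (𝓝[>] (0 : ℝ))
      (𝓝 0) := by
    have h2 : Tendsto (fun x : ℝ => ENNReal.ofReal (2 * ⨍ y in closedBall t x, ‖L y - L t‖))
        (𝓝[>] (0 : ℝ)) (𝓝 0) := by
      have := ENNReal.tendsto_ofReal (hlim.const_mul 2)
      simpa using this
    refine tendsto_of_tendsto_of_tendsto_of_le_of_le' tendsto_const_nhds h2
      (Eventually.of_forall fun _ => zero_le) ?_
    filter_upwards [self_mem_nhdsWithin] with x hx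
    have hx0 : (0 : ℝ) < x := hx
    refine (mul_le_mul_right (hball x hx0) _).trans ?_
    rw [← ENNReal.ofReal_mul (inv_nonneg.2 hx0.le)]
    refine ENNReal.ofReal_le_ofReal (le_of_eq ?_)
    rw [setAverage_eq, Measure.real, Real.volume_closedBall, ENNReal.toReal_ofReal (by positivity)]
    simp only [smul_eq_mul]
    field_simp
  have hfin₀ : ∫⁻ y, G₀ y ≠ ⊤ := by
    have hint : IntegrableOn (fun y => L (t + y) - L t) (Ioc (-Real.pi) Real.pi) := by
      refine Integrable.sub ?_ (integrableOn_const (by simp) (by simp))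
      have h3 : ∀ a b : ℝ, IntervalIntegrable L volume a b :=
        (periodic_comp_circleMap h).intervalIntegrable₀ Real.two_pi_pos.ne' hh
      have := (h3 (t + -Real.pi) (t + Real.pi)).comp_add_left t
      rw [add_sub_cancel_left, add_sub_cancel_left] at this
      exact (intervalIntegrable_iff_integrableOn_Ioc_of_le (by linarith [Real.pi_pos])).1 this
    rw [hG₀, lintegral_indicator measurableSet_Ioc]
    exact hint.2.ne
  have hae : ∀ᵐ y : ℝ, G₀ y = hG₀m.mk G₀ y := hG₀m.ae_eq_mk
  have hmain := tendsto_lintegral_mul_cauchyKernel hG₀m.measurable_mk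
    (by rwa [← lintegral_congr_ae hae])
    (hleb₀.congr fun x => by rw [lintegral_congr_ae (ae_restrict_of_ae hae)])
  have hmain' : Tendsto (fun h => ∫⁻ y, G₀ y * ENNReal.ofReal (h / (h ^ 2 + y ^ 2))) (𝓝[>] 0)
      (𝓝 0) :=
    hmain.congr fun h => lintegral_congr_ae (by filter_upwards [hae] with y hy; rw [hy])
  have hr : Tendsto (fun r : ℝ => 1 - r) (𝓝[<] 1) (𝓝[>] 0) := by
    refine tendsto_nhdsWithin_iff.2 ⟨?_, ?_⟩
    · have : Tendsto (fun r : ℝ => 1 - r) (𝓝 1) (𝓝 (1 - 1)) :=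
        (continuous_const.sub continuous_id).tendsto 1
      rw [sub_self] at this
      exact this.mono_left nhdsWithin_le_nhds
    · filter_upwards [self_mem_nhdsWithin] with r hr
      exact sub_pos.2 (mem_Iio.1 hr)
  set c : ENNReal := (ENNReal.ofReal (2 * Real.pi))⁻¹ * ENNReal.ofReal 10 with hc
  have hctop : c ≠ ⊤ := by
    refine ENNReal.mul_ne_top (ENNReal.inv_ne_top.2 ?_) ENNReal.ofReal_ne_top
    simp [Real.pi_pos]
  have hup := ENNReal.Tendsto.const_mul (a := c) (hmain'.comp hr) (Or.inr hctop)
  rw [mul_zero] at hup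
  rw [tendsto_iff_edist_tendsto_0]
  refine tendsto_of_tendsto_of_tendsto_of_le_of_le' tendsto_const_nhds hup
    (Eventually.of_forall fun _ => zero_le) ?_
  filter_upwards [Ioo_mem_nhdsLT (show (1 / 2 : ℝ) < 1 by norm_num)] with r hr
  have hz : (r : ℂ) * circleMap 0 1 t ∈ unitDisc :=
    real_mul_mem_unitDisc (by linarith [hr.1]) hr.2 (norm_circleMap_zero_one t).le
  have := isProbabilityMeasure_poissonMeasure hz
  have hI := integrable_poissonMeasure hz hLint
  have h4 : ∫ x, L x ∂poissonMeasure ((r : ℂ) * circleMap 0 1 t) - L t =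
      ∫ x, (L x - L t) ∂poissonMeasure ((r : ℂ) * circleMap 0 1 t) := by
    rw [integral_sub hI (integrable_const _)]
    simp
  rw [edist_eq_enorm_sub, h4]
  refine (enorm_integral_le_lintegral_enorm _).trans ?_
  have hm : AEMeasurable (fun x => ‖L x - L t‖ₑ) circleProb :=
    (hLint.1.sub aestronglyMeasurable_const).enorm
  rw [lintegral_poissonMeasure hz hm, circleProb,
    lintegral_smul_measure, setLIntegral_Ioc_periodic (fun x => by
      simp only [hL, periodic_circleMap 0 1 x]) t, hc, smul_eq_mul, mul_assoc]
  refine mul_le_mul_right ?_ _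
  simp only [Function.comp_apply]
  rw [← lintegral_const_mul'' _ (by fun_prop), ← lintegral_indicator measurableSet_Ioc]
  refine lintegral_mono fun y => ?_
  by_cases hy : y ∈ Ioc (-Real.pi) Real.pi
  · simp only [indicator_of_mem hy, hG₀]
    rw [mul_comm (‖L (t + y) - L t‖ₑ), ← mul_assoc, ← ENNReal.ofReal_mul (by norm_num)]
    refine mul_le_mul_left (ENNReal.ofReal_le_ofReal ?_) _
    refine le_trans (le_of_eq ?_)
      (poissonKernel_real_le hr.1.le hr.2 (abs_le.2 ⟨hy.1.le, hy.2⟩))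
    have h5 : circleMap 0 1 (t + y) - r * circleMap 0 1 t =
        circleMap 0 1 t * (circleMap 0 1 y - r) := by
      simp only [circleMap, zero_add, Complex.ofReal_one, one_mul, Complex.ofReal_add, add_mul,
        Complex.exp_add]
      ring
    rw [poissonKernel_circle, poissonKernel_circle, h5, norm_mul, norm_mul,
      norm_circleMap_zero_one, one_mul, mul_one]
  · rw [indicator_of_notMem hy]
    exact zero_le

/-! ### Boundary values of functions in `H²` -/

theorem tendsto_dilate {f : ℂ → ℂ} (hf : DifferentiableOn ℂ f unitDisc) {z : ℂ}
    (hz : z ∈ unitDisc) : Tendsto (fun ρ : ℝ => f (ρ * z)) (𝓝[<] 1) (𝓝 (f z)) := by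
  have h1 : ContinuousAt f z := (hf.differentiableAt (isOpen_ball.mem_nhds hz)).continuousAt
  exact h1.tendsto.comp (tendsto_real_mul z)

/-- A function in `H²` is the Poisson integral of a square integrable function, namely of a weak
limit point of its dilates. -/
theorem exists_memLp_two_poisson {f : ℂ → ℂ} (hf : f ∈ hardySpace 2) :
    ∃ F : ℝ → ℂ, MemLp F 2 circleProb ∧ ∀ z ∈ unitDisc, ∫ t, F t ∂poissonMeasure z = f z := by
  obtain ⟨hd, C, hC, hb⟩ := (mem_hardySpace_iff zero_le_two).1 hf
  have hn : ∀ ρ : ℝ, 0 < ρ → ρ < 1 →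
      eLpNorm (fun t => f (circleMap 0 ρ t)) 2 circleProb ≤ C ^ (1 / 2 : ℝ) := by
    intro ρ h0 h1
    rw [eLpNorm_eq_lintegral_rpow_enorm_toReal two_ne_zero ENNReal.ofNat_ne_top]
    simp only [ENNReal.toReal_ofNat]
    exact ENNReal.rpow_le_rpow (hb ρ h0 h1) (by norm_num)
  have hCt : C ^ (1 / 2 : ℝ) ≠ ⊤ := ENNReal.rpow_ne_top_of_nonneg (by norm_num) hC
  have hm : ∀ ρ : ℝ, 0 < ρ → ρ < 1 → MemLp (fun t => f (circleMap 0 ρ t)) 2 circleProb :=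
    fun ρ h0 h1 => ⟨(continuous_comp_circleMap hd.continuousOn h0 h1).aestronglyMeasurable,
      (hn ρ h0 h1).trans_lt hCt.lt_top⟩
  classical
  let e : ℝ → Lp ℂ 2 circleProb := fun ρ =>
    if h : 0 < ρ ∧ ρ < 1 then (hm ρ h.1 h.2).toLp _ else 0
  let φ : ℝ → WeakDual ℂ (Lp ℂ 2 circleProb) := fun ρ =>
    StrongDual.toWeakDual (InnerProductSpace.toDual ℂ _ (e ρ))
  have hφ : ∀ ρ, φ ρ ∈ WeakDual.toStrongDual ⁻¹'
      closedBall (0 : StrongDual ℂ (Lp ℂ 2 circleProb)) (C ^ (1 / 2 : ℝ)).toReal := by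
    intro ρ
    simp only [mem_preimage, mem_closedBall, dist_zero_right]
    change ‖InnerProductSpace.toDual ℂ _ (e ρ)‖ ≤ _
    rw [LinearIsometryEquiv.norm_map]
    by_cases h : 0 < ρ ∧ ρ < 1
    · simp only [e, dif_pos h]
      rw [Lp.norm_toLp]
      exact ENNReal.toReal_mono hCt (hn ρ h.1 h.2)
    · simp [e, dif_neg h]
  let U : Ultrafilter ℝ := Ultrafilter.of (𝓝[<] (1 : ℝ))
  obtain ⟨x, -, hx⟩ := (WeakDual.isCompact_closedBall (𝕜 := ℂ)
    (0 : StrongDual ℂ (Lp ℂ 2 circleProb)) (C ^ (1 / 2 : ℝ)).toReal).ultrafilter_le_nhds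
    (U.map φ) (by
      rw [le_principal_iff, Ultrafilter.mem_coe, Ultrafilter.mem_map]
      exact Eventually.of_forall hφ)
  let F : Lp ℂ 2 circleProb := (InnerProductSpace.toDual ℂ _).symm (WeakDual.toStrongDual x)
  refine ⟨F, Lp.memLp F, fun z hz => ?_⟩
  have hkm : MemLp (fun t => ((poissonKernel 0 z (circleMap 0 1 t) : ℝ) : ℂ)) 2 circleProb := by
    refine MemLp.of_bound (Continuous.aestronglyMeasurable
      (Complex.continuous_ofReal.comp (continuous_poissonKernel hz))) (1 / (1 - ‖z‖) ^ 2)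
      (Eventually.of_forall fun t => ?_)
    rw [Complex.norm_real, Real.norm_eq_abs, abs_of_nonneg (poissonKernel_nonneg hz t)]
    exact poissonKernel_le hz t
  let k : Lp ℂ 2 circleProb := hkm.toLp _
  have hinner : ∀ u : Lp ℂ 2 circleProb,
      inner ℂ u k = (starRingEnd ℂ) (∫ t, u t ∂poissonMeasure z) := by
    intro u
    rw [integral_poissonMeasure hz, ← integral_conj, MeasureTheory.L2.inner_def]
    refine integral_congr_ae ?_
    filter_upwards [hkm.coeFn_toLp] with t ht
    simp only [k, ht, RCLike.inner_apply, Complex.real_smul, map_mul, Complex.conj_ofReal]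
  have h1 : Tendsto (fun ρ => φ ρ k) U (𝓝 (x k)) :=
    ((WeakDual.eval_continuous k).tendsto x).comp hx
  have h2 : x k = (starRingEnd ℂ) (∫ t, F t ∂poissonMeasure z) := by
    rw [← hinner]
    exact (InnerProductSpace.toDual_symm_apply (𝕜 := ℂ) (y := WeakDual.toStrongDual x)).symm
  have h3 : Tendsto (fun ρ => φ ρ k) (𝓝[<] 1) (𝓝 ((starRingEnd ℂ) (f z))) := by
    refine ((Complex.continuous_conj.tendsto _).comp (tendsto_dilate hd hz)).congr' ?_
    filter_upwards [Ioo_mem_nhdsLT zero_lt_one] with ρ hρ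
    have h4 : φ ρ k = inner ℂ (e ρ) k := rfl
    rw [h4, hinner, Function.comp_apply, ← integral_dilate_poissonMeasure hd hρ.1 hρ.2 hz]
    congr 1
    have h5 : e ρ =ᵐ[circleProb] fun t => f (circleMap 0 ρ t) := by
      simp only [e, dif_pos (show 0 < ρ ∧ ρ < 1 from hρ)]
      exact MemLp.coeFn_toLp _
    exact (integral_congr_ae ((withDensity_absolutelyContinuous _ _).ae_eq h5)).symm
  have h6 := tendsto_nhds_unique h1 (h3.mono_left (Ultrafilter.of_le _))
  rw [h2] at h6
  exact (starRingEnd ℂ).injective h6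

/-- Every function on the interval of angles `(0, 2π]` comes from a function on the circle. -/
theorem exists_comp_circleMap {F : Type*} (u : ℝ → F) :
    ∃ h : ℂ → F, ∀ t ∈ Ioc 0 (2 * Real.pi), h (circleMap 0 1 t) = u t := by
  refine ⟨fun ζ => u (toIocMod Real.two_pi_pos 0 ζ.arg), fun t ht => ?_⟩
  have h1 : circleMap 0 1 t = Complex.exp (t * Complex.I) := by simp [circleMap]
  simp only [h1]
  rw [Complex.arg_exp_mul_I, toIocMod_toIocMod, (toIocMod_eq_self _).2 (by simpa using ht)]

theorem ae_circleProb_mem : ∀ᵐ t ∂circleProb, t ∈ Ioc 0 (2 * Real.pi) :=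
  Measure.ae_smul_measure (ae_restrict_mem measurableSet_Ioc) _

theorem ae_poissonMeasure {P : ℝ → Prop} {z : ℂ} (h : ∀ᵐ t ∂circleProb, P t) :
    ∀ᵐ t ∂poissonMeasure z, P t :=
  (withDensity_absolutelyContinuous _ _).ae_le h

/-- Functions in `H²` have radial limits almost everywhere. -/
theorem ae_exists_hasRadialLimit_of_mem_hardySpace_two {f : ℂ → ℂ} (hf : f ∈ hardySpace 2) :
    ∀ᵐ t : ℝ, ∃ w, HasRadialLimit f (circleMap 0 1 t) w := by
  obtain ⟨F, hF, hfF⟩ := exists_memLp_two_poisson hf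
  obtain ⟨h, hh⟩ := exists_comp_circleMap F
  have hae : ∀ᵐ t ∂circleProb, h (circleMap 0 1 t) = F t := by
    filter_upwards [ae_circleProb_mem] with t ht using hh t ht
  have hi : CircleIntegrable h 0 1 :=
    (circleIntegrable_iff_integrable_circleProb h 0 1).2
      ((hF.integrable one_le_two).congr (hae.mono fun t ht => ht.symm))
  filter_upwards [ae_tendsto_integral_poissonMeasure hi] with t ht
  refine ⟨h (circleMap 0 1 t), ht.congr' ?_⟩
  filter_upwards [eventually_real_mul_circleMap_mem t] with r hr
  rw [integral_congr_ae (ae_poissonMeasure hae), hfF _ hr]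

/-! ### Outer functions -/

/-- The modulus of an outer function is the exponential of a Poisson integral. -/
theorem norm_eq_exp_integral_poissonMeasure {g : ℂ → ℂ} {c : ℂ} {φ : ℂ → ℝ} (hc : ‖c‖ = 1)
    (hφ : CircleIntegrable (fun ζ => Real.log (φ ζ)) 0 1)
    (hg : ∀ z ∈ unitDisc, g z = c * Complex.exp
      (Real.circleAverage (fun ζ => herglotzRieszKernel 0 z ζ * (Real.log (φ ζ) : ℂ)) 0 1))
    {z : ℂ} (hz : z ∈ unitDisc) :
    ‖g z‖ = Real.exp (∫ t, Real.log (φ (circleMap 0 1 t)) ∂poissonMeasure z) := by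
  rw [hg z hz, norm_mul, hc, one_mul, Complex.norm_exp]
  congr 1
  have := re_circleAverage_herglotzRieszKernel_smul hφ hz
  simp only [smul_eq_mul] at this
  rw [this, circleAverage_eq_integral_circleProb, integral_poissonMeasure hz,
    poissonKernel_eq_re_herglotzRieszKernel]
  rfl

/-- An outer function in `H^p`, `p ≥ 1`, has radial limits almost everywhere, and their modulus is
the function that defines it. The limits exist because a square root of the outer function is in
`H²`; the modulus comes from Fatou's theorem for its logarithm. -/
theorem ae_hasRadialLimit_outer {g : ℂ → ℂ} {c : ℂ} {φ : ℂ → ℝ} (hc : ‖c‖ = 1)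
    (hφ0 : ∀ ζ, 0 < φ ζ) (hφ : CircleIntegrable (fun ζ => Real.log (φ ζ)) 0 1)
    (hg : ∀ z ∈ unitDisc, g z = c * Complex.exp
      (Real.circleAverage (fun ζ => herglotzRieszKernel 0 z ζ * (Real.log (φ ζ) : ℂ)) 0 1))
    {p : ℝ} (hp : 1 ≤ p) (hgp : g ∈ hardySpace p) :
    ∀ᵐ t : ℝ, HasRadialLimit g (circleMap 0 1 t) (boundaryValue g (circleMap 0 1 t)) ∧
      ‖boundaryValue g (circleMap 0 1 t)‖ = φ (circleMap 0 1 t) := by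
  have hφC : CircleIntegrable (fun ζ => (Real.log (φ ζ) : ℂ)) 0 1 := by
    rw [circleIntegrable_iff_integrable_circleProb] at hφ ⊢
    exact hφ.ofReal
  set H : ℂ → ℂ := fun z =>
    Real.circleAverage (fun ζ => herglotzRieszKernel 0 z ζ * (Real.log (φ ζ) : ℂ)) 0 1 with hH
  have hHd : DifferentiableOn ℂ H unitDisc :=
    differentiableOn_circleAverage_herglotzRieszKernel_smul hφC
  set K : ℂ → ℂ := fun z => Complex.exp (H z / 2) with hK
  have hKd : DifferentiableOn ℂ K unitDisc := (hHd.div_const 2).cexp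
  have hgK : ∀ z ∈ unitDisc, g z = c * K z ^ 2 := by
    intro z hz
    rw [hg z hz, hK, ← Complex.exp_nat_mul]
    congr 2
    push_cast
    ring
  have hK2 : K ∈ hardySpace 2 := by
    obtain ⟨hd, C, hC, hb⟩ := (mem_hardySpace_iff (by linarith)).1 hgp
    refine (mem_hardySpace_iff zero_le_two).2 ⟨hKd, 1 + C, by finiteness, fun ρ h0 h1 => ?_⟩
    calc ∫⁻ t, ‖K (circleMap 0 ρ t)‖ₑ ^ (2 : ℝ) ∂circleProb
        ≤ ∫⁻ t, (1 + ‖g (circleMap 0 ρ t)‖ₑ ^ p) ∂circleProb := by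
          refine lintegral_mono fun t => ?_
          have h3 : ‖K (circleMap 0 ρ t)‖ₑ ^ (2 : ℝ) = ‖g (circleMap 0 ρ t)‖ₑ := by
            have hc' : ‖c‖ₑ = 1 := by rw [← ofReal_norm, hc, ENNReal.ofReal_one]
            rw [hgK _ (circleMap_mem_unitDisc h0 h1 t), enorm_mul, hc', one_mul, enorm_pow]
            exact ENNReal.rpow_two _
          simp only [h3]
          rcases le_total ‖g (circleMap 0 ρ t)‖ₑ 1 with h | h
          · exact h.trans le_self_add
          · refine le_trans ?_ le_add_self
            conv_lhs => rw [← ENNReal.rpow_one ‖g (circleMap 0 ρ t)‖ₑ]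
            exact ENNReal.rpow_le_rpow_of_exponent_le h hp
      _ ≤ 1 + C := by
          rw [lintegral_add_left measurable_const]
          simp only [lintegral_const, measure_univ, mul_one]
          gcongr
          exact hb ρ h0 h1
  filter_upwards [ae_exists_hasRadialLimit_of_mem_hardySpace_two hK2,
    ae_tendsto_integral_poissonMeasure hφC] with t ⟨w, hw⟩ ht
  have hmem := eventually_real_mul_circleMap_mem t
  have h1 : HasRadialLimit g (circleMap 0 1 t) (c * w ^ 2) := by
    refine ((Tendsto.pow hw 2).const_mul c).congr' ?_
    filter_upwards [hmem] with r hr using (hgK _ hr).symm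
  have h2 : boundaryValue g (circleMap 0 1 t) = c * w ^ 2 := h1.limUnder_eq
  rw [h2]
  refine ⟨h1, ?_⟩
  have h3 : Tendsto (fun r : ℝ => ‖g ((r : ℂ) * circleMap 0 1 t)‖) (𝓝[<] 1)
      (𝓝 (φ (circleMap 0 1 t))) := by
    have h4 := (Real.continuous_exp.tendsto _).comp ((Complex.continuous_re.tendsto _).comp ht)
    rw [Complex.ofReal_re, Real.exp_log (hφ0 _)] at h4
    refine h4.congr' ?_
    filter_upwards [hmem] with r hr
    rw [norm_eq_exp_integral_poissonMeasure hc hφ hg hr]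
    simp only [Function.comp_apply]
    rw [integral_complex_ofReal, Complex.ofReal_re]
  exact tendsto_nhds_unique h1.norm h3

/-- By Jensen's inequality, the reciprocal of an outer function has integral means of order `s`
bounded by that of its boundary values. -/
theorem lintegral_inv_outer_le {g : ℂ → ℂ} {c : ℂ} {φ : ℂ → ℝ} (hc : ‖c‖ = 1)
    (hφ0 : ∀ ζ, 0 < φ ζ) (hφ : CircleIntegrable (fun ζ => Real.log (φ ζ)) 0 1)
    (hg : ∀ z ∈ unitDisc, g z = c * Complex.exp
      (Real.circleAverage (fun ζ => herglotzRieszKernel 0 z ζ * (Real.log (φ ζ) : ℂ)) 0 1))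
    {s : ℝ} (hs : 0 < s)
    (hint : ∫⁻ t, ENNReal.ofReal ((φ (circleMap 0 1 t)) ^ (-s)) ∂circleProb ≠ ⊤)
    {ρ : ℝ} (h0 : 0 < ρ) (h1 : ρ < 1) :
    ∫⁻ t, ‖(g (circleMap 0 ρ t))⁻¹‖ₑ ^ s ∂circleProb ≤
      ∫⁻ t, ENNReal.ofReal ((φ (circleMap 0 1 t)) ^ (-s)) ∂circleProb := by
  have hlog := (circleIntegrable_iff_integrable_circleProb _ 0 1).1 hφ
  have hexp : ∀ t, (φ (circleMap 0 1 t)) ^ (-s) =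
      Real.exp (-s * Real.log (φ (circleMap 0 1 t))) := fun t => by
    rw [Real.rpow_def_of_pos (hφ0 _), mul_comm]
  have hmeas : AEStronglyMeasurable (fun t => (φ (circleMap 0 1 t)) ^ (-s)) circleProb := by
    simp_rw [hexp]
    exact Real.continuous_exp.comp_aestronglyMeasurable (hlog.1.const_mul _)
  have hi : Integrable (fun t => (φ (circleMap 0 1 t)) ^ (-s)) circleProb := by
    refine ⟨hmeas, ?_⟩
    rw [hasFiniteIntegral_iff_ofReal
      (Eventually.of_forall fun t => Real.rpow_nonneg (hφ0 _).le _)]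
    exact hint.lt_top
  rw [← lintegral_lintegral_poissonMeasure hmeas.aemeasurable.ennreal_ofReal h0 h1]
  refine lintegral_mono fun t => ?_
  have hz := circleMap_mem_unitDisc h0 h1 t
  have := isProbabilityMeasure_poissonMeasure hz
  rw [← ofReal_integral_eq_lintegral_ofReal (integrable_poissonMeasure hz hi)
    (Eventually.of_forall fun t => Real.rpow_nonneg (hφ0 _).le _), ← ofReal_norm_rpow _ hs.le]
  refine ENNReal.ofReal_le_ofReal ?_
  have hlogz := (integrable_poissonMeasure hz hlog).const_mul (-s)
  have hJ := ConvexOn.map_integral_le (μ := poissonMeasure (circleMap 0 ρ t)) convexOn_exp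
    Real.continuous_exp.continuousOn isClosed_univ (Eventually.of_forall fun _ => mem_univ _) hlogz
    (by
      refine (integrable_poissonMeasure hz hi).congr (Eventually.of_forall fun t => ?_)
      simp only [hexp, Function.comp_apply])
  simp_rw [hexp]
  refine le_trans (le_of_eq ?_) hJ
  rw [norm_inv, norm_eq_exp_integral_poissonMeasure hc hφ hg hz, ← Real.exp_neg, ← Real.exp_mul,
    integral_const_mul]
  congr 1
  ring

/-! ### Boundary values of functions in `H^r`, `r > 1` -/

/-- Pointwise limits of a sequence that is bounded in `L^r`, `r > 1`, may be taken under the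
integral sign. -/
theorem tendsto_integral_of_lintegral_rpow_le {α : Type*} [MeasurableSpace α] {μ : Measure α}
    [IsFiniteMeasure μ] {r : ℝ} (hr : 1 < r) {u : ℕ → α → ℂ} {v : α → ℂ}
    (hu : ∀ n, AEStronglyMeasurable (u n) μ) {C : ENNReal} (hC : C ≠ ⊤)
    (hb : ∀ n, ∫⁻ x, ‖u n x‖ₑ ^ r ∂μ ≤ C)
    (hv : ∀ᵐ x ∂μ, Tendsto (fun n => u n x) atTop (𝓝 (v x))) :
    Tendsto (fun n => ∫ x, u n x ∂μ) atTop (𝓝 (∫ x, v x ∂μ)) := by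
  have hr0 : 0 < r := by linarith
  have hle : ∀ x : ENNReal, x ≤ 1 + x ^ r := by
    intro x
    rcases le_total x 1 with h | h
    · exact h.trans le_self_add
    · refine le_trans ?_ le_add_self
      conv_lhs => rw [← ENNReal.rpow_one x]
      exact ENNReal.rpow_le_rpow_of_exponent_le h hr.le
  have hvm : AEStronglyMeasurable v μ := aestronglyMeasurable_of_tendsto_ae atTop hu hv
  have hvC : ∫⁻ x, ‖v x‖ₑ ^ r ∂μ ≤ C := by
    calc ∫⁻ x, ‖v x‖ₑ ^ r ∂μ = ∫⁻ x, liminf (fun n => ‖u n x‖ₑ ^ r) atTop ∂μ := by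
          refine lintegral_congr_ae ?_
          filter_upwards [hv] with x hx
          exact ((ENNReal.continuous_rpow_const.tendsto _).comp hx.enorm).liminf_eq.symm
      _ ≤ liminf (fun n => ∫⁻ x, ‖u n x‖ₑ ^ r ∂μ) atTop :=
          lintegral_liminf_le' fun n => (hu n).enorm.pow_const r
      _ ≤ C := liminf_le_of_le (by isBoundedDefault) fun b hb' =>
          (hb'.and (Eventually.of_forall hb)).exists.elim fun n hn => hn.1.trans hn.2
  have hint : ∀ w : α → ℂ, AEStronglyMeasurable w μ → ∫⁻ x, ‖w x‖ₑ ^ r ∂μ ≤ C →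
      Integrable w μ := by
    intro w hw hwC
    refine ⟨hw, ?_⟩
    calc ∫⁻ x, ‖w x‖ₑ ∂μ ≤ ∫⁻ x, (1 + ‖w x‖ₑ ^ r) ∂μ := lintegral_mono fun x => hle _
      _ = μ univ + ∫⁻ x, ‖w x‖ₑ ^ r ∂μ := by
          rw [lintegral_add_left measurable_const, lintegral_const, one_mul]
      _ < ⊤ := ENNReal.add_lt_top.2 ⟨measure_lt_top _ _, hwC.trans_lt hC.lt_top⟩
  have hUI : UnifIntegrable u 1 μ := by
    refine unifIntegrable_of le_rfl ENNReal.one_ne_top hu fun ε hε => ?_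
    -- on `{‖u n‖ ≥ K}` one has `‖u n‖ ≤ K ^ (1 - r) * ‖u n‖ ^ r`
    obtain ⟨K, hK0, hK⟩ : ∃ K : NNReal, 0 < K ∧
        (K : ENNReal) ^ (1 - r) * C ≤ ENNReal.ofReal ε := by
      have h1 : Tendsto (fun K : ℝ => K ^ (1 - r) * C.toReal) atTop (𝓝 0) := by
        have := (tendsto_rpow_neg_atTop (sub_pos.2 hr)).mul_const C.toReal
        simpa using this
      obtain ⟨K, hK1, hK0⟩ := ((h1.eventually (gt_mem_nhds hε)).and (eventually_gt_atTop 0)).exists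
      refine ⟨K.toNNReal, Real.toNNReal_pos.2 hK0, ?_⟩
      change ENNReal.ofReal K ^ (1 - r) * C ≤ ENNReal.ofReal ε
      rw [ENNReal.ofReal_rpow_of_pos hK0]
      conv_lhs => rw [← ENNReal.ofReal_toReal hC]
      rw [← ENNReal.ofReal_mul (by positivity)]
      exact ENNReal.ofReal_le_ofReal hK1.le
    refine ⟨K, fun n => ?_⟩
    rw [eLpNorm_one_eq_lintegral_enorm]
    refine le_trans ?_ hK
    calc ∫⁻ x, ‖({x | K ≤ ‖u n x‖₊} : Set α).indicator (u n) x‖ₑ ∂μ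
        ≤ ∫⁻ x, (K : ENNReal) ^ (1 - r) * ‖u n x‖ₑ ^ r ∂μ := by
          refine lintegral_mono fun x => ?_
          by_cases hx : x ∈ {x | K ≤ ‖u n x‖₊}
          · rw [indicator_of_mem hx]
            have hKx : (K : ENNReal) ≤ ‖u n x‖ₑ := by
              rw [enorm_eq_nnnorm]
              exact_mod_cast hx
            have hK0' : (K : ENNReal) ≠ 0 := by exact_mod_cast hK0.ne'
            have hx0 : ‖u n x‖ₑ ≠ 0 := fun h => hK0' (le_zero_iff.1 (h ▸ hKx))
            calc ‖u n x‖ₑ = ‖u n x‖ₑ ^ (1 - r) * ‖u n x‖ₑ ^ r := by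
                  rw [← ENNReal.rpow_add _ _ hx0 enorm_ne_top]
                  simp
              _ ≤ (K : ENNReal) ^ (1 - r) * ‖u n x‖ₑ ^ r := by
                  gcongr ?_ * _
                  rw [← neg_sub r 1, ENNReal.rpow_neg, ENNReal.rpow_neg]
                  exact ENNReal.inv_le_inv.2 (ENNReal.rpow_le_rpow hKx (by linarith))
          · rw [indicator_of_notMem hx, enorm_zero]
            exact zero_le
      _ = (K : ENNReal) ^ (1 - r) * ∫⁻ x, ‖u n x‖ₑ ^ r ∂μ :=
          lintegral_const_mul'' _ ((hu n).enorm.pow_const r)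
      _ ≤ _ := by gcongr; exact hb n
  have hL1 := tendsto_Lp_finite_of_tendsto_ae le_rfl ENNReal.one_ne_top hu
    (memLp_one_iff_integrable.2 (hint v hvm hvC)) hUI hv
  exact tendsto_integral_of_L1' v hvm
    (Eventually.of_forall fun n => hint _ (hu n) (hb n)) hL1

/-- A sequence of radii in `(0, 1)` that tends to `1`. -/
noncomputable def radius (n : ℕ) : ℝ := 1 - 1 / ((n : ℝ) + 2)

theorem radius_pos (n : ℕ) : 0 < radius n := by
  rw [radius, sub_pos, div_lt_one (by positivity)]
  linarith [n.cast_nonneg (α := ℝ)]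

theorem radius_lt_one (n : ℕ) : radius n < 1 := by
  rw [radius, sub_lt_self_iff]
  positivity

theorem tendsto_radius : Tendsto radius atTop (𝓝[<] 1) := by
  refine tendsto_nhdsWithin_iff.2 ⟨?_, Eventually.of_forall radius_lt_one⟩
  have h : Tendsto (fun n : ℕ => (1 : ℝ) / ((n : ℝ) + 2)) atTop (𝓝 0) :=
    tendsto_const_nhds.div_atTop (tendsto_atTop_add_const_right _ _ tendsto_natCast_atTop_atTop)
  have h2 := h.const_sub 1
  rw [sub_zero] at h2
  exact h2

theorem HasRadialLimit.boundaryValue_eq {f : ℂ → ℂ} {ζ w : ℂ} (h : HasRadialLimit f ζ w) :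
    boundaryValue f ζ = w := h.limUnder_eq

theorem HasRadialLimit.hasRadialLimit_boundaryValue {f : ℂ → ℂ} {ζ w : ℂ}
    (h : HasRadialLimit f ζ w) : HasRadialLimit f ζ (boundaryValue f ζ) := by
  rwa [h.boundaryValue_eq]

theorem HasRadialLimit.tendsto_radius {f : ℂ → ℂ} {t : ℝ} {w : ℂ}
    (h : HasRadialLimit f (circleMap 0 1 t) w) :
    Tendsto (fun n => f (circleMap 0 (radius n) t)) atTop (𝓝 w) := by
  simp_rw [circleMap_zero_eq_mul (radius _)]
  have h' : Tendsto (fun r : ℝ => f ((r : ℂ) * circleMap 0 1 t)) (𝓝[<] 1) (𝓝 w) := h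
  exact h'.comp _root_.tendsto_radius

theorem aestronglyMeasurable_boundaryValue {f : ℂ → ℂ} (hf : DifferentiableOn ℂ f unitDisc)
    (hlim : ∀ᵐ t : ℝ, ∃ w, HasRadialLimit f (circleMap 0 1 t) w) :
    AEStronglyMeasurable (fun t => boundaryValue f (circleMap 0 1 t)) circleProb := by
  refine aestronglyMeasurable_of_tendsto_ae (u := atTop)
    (f := fun n t => f (circleMap 0 (radius n) t)) (fun n =>
      (continuous_comp_circleMap hf.continuousOn (radius_pos n)
        (radius_lt_one n)).aestronglyMeasurable) ?_
  filter_upwards [ae_circleProb hlim] with t ht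
  obtain ⟨w, hw⟩ := ht
  exact hw.hasRadialLimit_boundaryValue.tendsto_radius

theorem lintegral_boundaryValue_lt_top {p : ℝ} (hp : 0 ≤ p) {f : ℂ → ℂ} (hf : f ∈ hardySpace p)
    (hlim : ∀ᵐ t : ℝ, ∃ w, HasRadialLimit f (circleMap 0 1 t) w) :
    ∫⁻ t, ‖boundaryValue f (circleMap 0 1 t)‖ₑ ^ p ∂circleProb ≠ ⊤ := by
  obtain ⟨hd, C, hC, hb⟩ := (mem_hardySpace_iff hp).1 hf
  refine ne_top_of_le_ne_top hC ?_
  calc ∫⁻ t, ‖boundaryValue f (circleMap 0 1 t)‖ₑ ^ p ∂circleProb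
      = ∫⁻ t, liminf (fun n => ‖f (circleMap 0 (radius n) t)‖ₑ ^ p) atTop ∂circleProb := by
        refine lintegral_congr_ae ?_
        filter_upwards [ae_circleProb hlim] with t ht
        obtain ⟨w, hw⟩ := ht
        exact ((ENNReal.continuous_rpow_const.tendsto _).comp
          hw.hasRadialLimit_boundaryValue.tendsto_radius.enorm).liminf_eq.symm
    _ ≤ liminf (fun n => ∫⁻ t, ‖f (circleMap 0 (radius n) t)‖ₑ ^ p ∂circleProb) atTop :=
        lintegral_liminf_le' fun n => ((continuous_comp_circleMap hd.continuousOn (radius_pos n)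
          (radius_lt_one n)).aestronglyMeasurable).enorm.pow_const p
    _ ≤ C := liminf_le_of_le (by isBoundedDefault) fun b hb' =>
        (hb'.and (Eventually.of_forall fun n => hb _ (radius_pos n) (radius_lt_one n))).exists.elim
          fun n hn => hn.1.trans hn.2

/-- Integrals of the dilates of a function in `H^r`, `r > 1`, against a continuous function
converge to the integral of its boundary values. -/
theorem tendsto_integral_mul_dilate {r : ℝ} (hr : 1 < r) {f : ℂ → ℂ} (hf : f ∈ hardySpace r)
    (hlim : ∀ᵐ t : ℝ, ∃ w, HasRadialLimit f (circleMap 0 1 t) w) {k : ℝ → ℂ} (hk : Continuous k)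
    {M : ℝ} (hM : ∀ t, ‖k t‖ ≤ M) :
    Tendsto (fun n => ∫ t, k t * f (circleMap 0 (radius n) t) ∂circleProb) atTop
      (𝓝 (∫ t, k t * boundaryValue f (circleMap 0 1 t) ∂circleProb)) := by
  have hr0 : 0 ≤ r := by linarith
  obtain ⟨hd, C, hC, hb⟩ := (mem_hardySpace_iff hr0).1 hf
  have hc := fun n => continuous_comp_circleMap hd.continuousOn (radius_pos n) (radius_lt_one n)
  refine tendsto_integral_of_lintegral_rpow_le hr
    (fun n => (hk.mul (hc n)).aestronglyMeasurable)
    (C := ENNReal.ofReal M ^ r * C)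
    (ENNReal.mul_ne_top (ENNReal.rpow_ne_top_of_nonneg hr0 ENNReal.ofReal_ne_top) hC)
    (fun n => ?_) ?_
  · calc ∫⁻ t, ‖k t * f (circleMap 0 (radius n) t)‖ₑ ^ r ∂circleProb
        ≤ ∫⁻ t, ENNReal.ofReal M ^ r * ‖f (circleMap 0 (radius n) t)‖ₑ ^ r ∂circleProb := by
          refine lintegral_mono fun t => ?_
          rw [← ENNReal.mul_rpow_of_nonneg _ _ hr0, enorm_mul]
          gcongr
          rw [← ofReal_norm]
          exact ENNReal.ofReal_le_ofReal (hM t)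
      _ = ENNReal.ofReal M ^ r * ∫⁻ t, ‖f (circleMap 0 (radius n) t)‖ₑ ^ r ∂circleProb :=
          lintegral_const_mul _ ((hc n).measurable.enorm.pow_const r)
      _ ≤ _ := by gcongr; exact hb _ (radius_pos n) (radius_lt_one n)
  · filter_upwards [ae_circleProb hlim] with t ht
    obtain ⟨w, hw⟩ := ht
    exact (hw.hasRadialLimit_boundaryValue.tendsto_radius).const_mul (k t)

/-- A function in `H^r`, `r > 1`, is the Poisson integral of its boundary values. -/
theorem integral_boundaryValue_poissonMeasure {r : ℝ} (hr : 1 < r) {f : ℂ → ℂ}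
    (hf : f ∈ hardySpace r) (hlim : ∀ᵐ t : ℝ, ∃ w, HasRadialLimit f (circleMap 0 1 t) w) {z : ℂ}
    (hz : z ∈ unitDisc) :
    ∫ t, boundaryValue f (circleMap 0 1 t) ∂poissonMeasure z = f z := by
  have h := tendsto_integral_mul_dilate hr hf hlim
    (Complex.continuous_ofReal.comp (continuous_poissonKernel hz)) (M := 1 / (1 - ‖z‖) ^ 2)
    (fun t => by
      rw [Function.comp_apply, Complex.norm_real, Real.norm_eq_abs,
        abs_of_nonneg (poissonKernel_nonneg hz t)]
      exact poissonKernel_le hz t)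
  have h2 := (tendsto_dilate hf.1 hz).comp tendsto_radius
  rw [integral_poissonMeasure hz]
  refine tendsto_nhds_unique (h.congr fun n => ?_) h2
  rw [Function.comp_apply,
    ← integral_dilate_poissonMeasure hf.1 (radius_pos n) (radius_lt_one n) hz,
    integral_poissonMeasure hz]
  rfl

theorem continuous_cauchyKernel {z : ℂ} (hz : z ∈ unitDisc) :
    Continuous fun t => circleMap 0 1 t / (circleMap 0 1 t - z) :=
  Continuous.div (by fun_prop) (by fun_prop) fun t => circleMap_sub_ne_zero hz t

theorem norm_cauchyKernel_le {z : ℂ} (hz : z ∈ unitDisc) (t : ℝ) :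
    ‖circleMap 0 1 t / (circleMap 0 1 t - z)‖ ≤ 1 / (1 - ‖z‖) := by
  have h1 := norm_lt_one_of_mem_unitDisc hz
  rw [norm_div, norm_circleMap_zero_one]
  have := norm_sub_norm_le (circleMap 0 1 t) z
  rw [norm_circleMap_zero_one] at this
  exact one_div_le_one_div_of_le (by linarith) this

/-- Cauchy's formula for functions in `H^r`, `r > 1`. -/
theorem integral_cauchy_boundaryValue {r : ℝ} (hr : 1 < r) {f : ℂ → ℂ}
    (hf : f ∈ hardySpace r) (hlim : ∀ᵐ t : ℝ, ∃ w, HasRadialLimit f (circleMap 0 1 t) w) {z : ℂ}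
    (hz : z ∈ unitDisc) :
    ∫ t, circleMap 0 1 t / (circleMap 0 1 t - z) * boundaryValue f (circleMap 0 1 t) ∂circleProb =
      f z := by
  have h := tendsto_integral_mul_dilate hr hf hlim (continuous_cauchyKernel hz)
    (norm_cauchyKernel_le hz)
  have h2 := (tendsto_dilate hf.1 hz).comp tendsto_radius
  refine tendsto_nhds_unique (h.congr fun n => ?_) h2
  exact integral_dilate_cauchy hf.1 (radius_pos n) (radius_lt_one n) hz

theorem integral_cauchy_conj_boundaryValue {r : ℝ} (hr : 1 < r) {f : ℂ → ℂ}
    (hf : f ∈ hardySpace r) (hlim : ∀ᵐ t : ℝ, ∃ w, HasRadialLimit f (circleMap 0 1 t) w) {z : ℂ}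
    (hz : z ∈ unitDisc) :
    ∫ t, circleMap 0 1 t / (circleMap 0 1 t - z) *
      (starRingEnd ℂ) (boundaryValue f (circleMap 0 1 t)) ∂circleProb = (starRingEnd ℂ) (f 0) := by
  have h := tendsto_integral_mul_dilate hr hf hlim
    (k := fun t => (starRingEnd ℂ) (circleMap 0 1 t / (circleMap 0 1 t - z)))
    (Complex.continuous_conj.comp (continuous_cauchyKernel hz)) (M := 1 / (1 - ‖z‖)) fun t => by
      rw [RCLike.norm_conj]
      exact norm_cauchyKernel_le hz t
  have h' := (Complex.continuous_conj.tendsto _).comp h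
  rw [← integral_conj] at h'
  simp only [map_mul, Complex.conj_conj] at h'
  refine tendsto_nhds_unique h' (tendsto_const_nhds.congr fun n => ?_)
  rw [Function.comp_apply, ← integral_conj,
    ← integral_dilate_conj_cauchy hf.1 (radius_pos n) (radius_lt_one n) hz]
  simp only [map_mul, Complex.conj_conj]

/-- **Smirnov's theorem**: a function in `H^r`, `r > 1`, whose boundary values are in `L^p` is in
`H^p`. -/
theorem mem_hardySpace_of_lintegral_boundaryValue {r p : ℝ} (hr : 1 < r) (hp : 1 ≤ p) {f : ℂ → ℂ}
    (hf : f ∈ hardySpace r) (hlim : ∀ᵐ t : ℝ, ∃ w, HasRadialLimit f (circleMap 0 1 t) w)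
    (hfin : ∫⁻ t, ‖boundaryValue f (circleMap 0 1 t)‖ₑ ^ p ∂circleProb ≠ ⊤) :
    f ∈ hardySpace p := by
  have hp0 : 0 < p := by linarith
  have hm := aestronglyMeasurable_boundaryValue hf.1 hlim
  refine (mem_hardySpace_iff hp0.le).2 ⟨hf.1, _, hfin, fun ρ h0 h1 => ?_⟩
  rw [← lintegral_lintegral_poissonMeasure (hm.enorm.pow_const p) h0 h1]
  refine lintegral_mono fun t => ?_
  have hz := circleMap_mem_unitDisc h0 h1 t
  have := isProbabilityMeasure_poissonMeasure hz
  have hm' : AEStronglyMeasurable (fun t => boundaryValue f (circleMap 0 1 t))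
      (poissonMeasure (circleMap 0 ρ t)) := hm.mono_ac (withDensity_absolutelyContinuous _ _)
  rw [← integral_boundaryValue_poissonMeasure hr hf hlim hz]
  have h2 := eLpNorm_le_eLpNorm_of_exponent_le (p := 1) (q := ENNReal.ofReal p)
    (by simpa using ENNReal.ofReal_le_ofReal hp) hm'
  rw [eLpNorm_one_eq_lintegral_enorm, eLpNorm_eq_lintegral_rpow_enorm_toReal
    (by simpa using hp0) ENNReal.ofReal_ne_top, ENNReal.toReal_ofReal hp0.le] at h2
  have h3 := ENNReal.rpow_le_rpow ((enorm_integral_le_lintegral_enorm _).trans h2) hp0.le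
  rwa [← ENNReal.rpow_mul, one_div_mul_cancel hp0.ne', ENNReal.rpow_one] at h3

/-! ### Analytic continuation across a segment -/

/-- The open square of half-side `A` centred at the origin, without the real axis. -/
def slitSquare (A : ℝ) : Set ℂ := {w | |w.re| < A ∧ |w.im| < A ∧ w.im ≠ 0}

/-- The part of the boundary of the square of half-side `a` at height at least `h` above or below
the real axis. -/
def slitSquareBoundary (a h : ℝ) : Set ℂ :=
  {w | |w.re| ≤ a ∧ |w.im| ≤ a ∧ h ≤ |w.im| ∧ (|w.re| = a ∨ |w.im| = a)}

/-- The integral along `slitSquareBoundary a h`, counterclockwise. -/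
noncomputable def slitSquareIntegral (a h : ℝ) (G : ℂ → ℂ) : ℂ :=
  (∫ x : ℝ in -a..a, G (x + (-a : ℝ) * Complex.I)) - (∫ x : ℝ in -a..a, G (x + a * Complex.I)) +
    Complex.I * (∫ y : ℝ in h..a, G (a + y * Complex.I)) -
    Complex.I * (∫ y : ℝ in h..a, G ((-a : ℝ) + y * Complex.I)) +
    Complex.I * (∫ y : ℝ in (-a)..(-h), G (a + y * Complex.I)) -
    Complex.I * (∫ y : ℝ in (-a)..(-h), G ((-a : ℝ) + y * Complex.I))

section SlitSquare

variable {a h : ℝ}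

theorem horizontal_mem_slitSquareBoundary (hha : h ≤ a) {s : ℝ} (hs : |s| = a)
    {x : ℝ} (hx : x ∈ Icc (-a) a) : (x : ℂ) + s * Complex.I ∈ slitSquareBoundary a h := by
  simp [slitSquareBoundary, hs, hha, abs_le.2 hx]

theorem vertical_mem_slitSquareBoundary {s : ℝ} (hs : |s| = a)
    {y : ℝ} (hy : |y| ≤ a) (hhy : h ≤ |y|) :
    (s : ℂ) + y * Complex.I ∈ slitSquareBoundary a h := by
  simp [slitSquareBoundary, hs, hy, hhy]

theorem upper_mem {y : ℝ} (h0 : 0 < h) (hy : y ∈ Icc h a) : |y| ≤ a ∧ h ≤ |y| := by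
  rw [abs_of_nonneg (h0.le.trans hy.1)]
  exact ⟨hy.2, hy.1⟩

theorem lower_mem {y : ℝ} (h0 : 0 < h) (hy : y ∈ Icc (-a) (-h)) : |y| ≤ a ∧ h ≤ |y| := by
  rw [abs_of_nonpos (by linarith [hy.2])]
  exact ⟨by linarith [hy.1], by linarith [hy.2]⟩

theorem continuousOn_horizontal (hha : h ≤ a) {G : ℂ → ℂ}
    (hG : ContinuousOn G (slitSquareBoundary a h)) {s : ℝ} (hs : |s| = a) :
    ContinuousOn (fun x : ℝ => G (x + s * Complex.I)) (Icc (-a) a) :=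
  hG.comp (by fun_prop) fun _ hx => horizontal_mem_slitSquareBoundary hha hs hx

theorem continuousOn_upper (h0 : 0 < h) {G : ℂ → ℂ}
    (hG : ContinuousOn G (slitSquareBoundary a h)) {s : ℝ} (hs : |s| = a) :
    ContinuousOn (fun y : ℝ => G (s + y * Complex.I)) (Icc h a) :=
  hG.comp (by fun_prop) fun _ hy =>
    vertical_mem_slitSquareBoundary hs (upper_mem h0 hy).1 (upper_mem h0 hy).2

theorem continuousOn_lower (h0 : 0 < h) {G : ℂ → ℂ}
    (hG : ContinuousOn G (slitSquareBoundary a h)) {s : ℝ} (hs : |s| = a) :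
    ContinuousOn (fun y : ℝ => G (s + y * Complex.I)) (Icc (-a) (-h)) :=
  hG.comp (by fun_prop) fun _ hy =>
    vertical_mem_slitSquareBoundary hs (lower_mem h0 hy).1 (lower_mem h0 hy).2

theorem abs_neg_self_of_pos (ha : 0 < a) : |(-a)| = a := by rw [abs_neg, abs_of_pos ha]

theorem slitSquareIntegral_add (h0 : 0 < h) (hha : h ≤ a) {G K : ℂ → ℂ}
    (hG : ContinuousOn G (slitSquareBoundary a h)) (hK : ContinuousOn K (slitSquareBoundary a h)) :
    slitSquareIntegral a h (fun w => G w + K w) =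
      slitSquareIntegral a h G + slitSquareIntegral a h K := by
  have ha : 0 < a := h0.trans_le hha
  have e1 : -a ≤ a := by linarith
  have e2 : -a ≤ -h := by linarith
  have i1 : ∀ {J : ℂ → ℂ}, ContinuousOn J (slitSquareBoundary a h) → ∀ {s : ℝ}, |s| = a →
      IntervalIntegrable (fun x : ℝ => J (x + s * Complex.I)) volume (-a) a := fun hJ _ hs =>
    (continuousOn_horizontal hha hJ hs).intervalIntegrable_of_Icc e1
  have i2 : ∀ {J : ℂ → ℂ}, ContinuousOn J (slitSquareBoundary a h) → ∀ {s : ℝ}, |s| = a →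
      IntervalIntegrable (fun y : ℝ => J (s + y * Complex.I)) volume h a := fun hJ _ hs =>
    (continuousOn_upper h0 hJ hs).intervalIntegrable_of_Icc hha
  have i3 : ∀ {J : ℂ → ℂ}, ContinuousOn J (slitSquareBoundary a h) → ∀ {s : ℝ}, |s| = a →
      IntervalIntegrable (fun y : ℝ => J (s + y * Complex.I)) volume (-a) (-h) := fun hJ _ hs =>
    (continuousOn_lower h0 hJ hs).intervalIntegrable_of_Icc e2
  have n1 := abs_of_pos ha
  have n2 := abs_neg_self_of_pos ha
  simp only [slitSquareIntegral]
  rw [intervalIntegral.integral_add (i1 hG n2) (i1 hK n2),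
    intervalIntegral.integral_add (i1 hG n1) (i1 hK n1),
    intervalIntegral.integral_add (i2 hG n1) (i2 hK n1),
    intervalIntegral.integral_add (i2 hG n2) (i2 hK n2),
    intervalIntegral.integral_add (i3 hG n1) (i3 hK n1),
    intervalIntegral.integral_add (i3 hG n2) (i3 hK n2)]
  ring

theorem slitSquareIntegral_const_mul (c : ℂ) (G : ℂ → ℂ) :
    slitSquareIntegral a h (fun w => c * G w) = c * slitSquareIntegral a h G := by
  simp only [slitSquareIntegral, intervalIntegral.integral_const_mul]
  ring

theorem norm_slitSquareIntegral_le (h0 : 0 < h) (hha : h ≤ a) {G : ℂ → ℂ} {B : ℝ}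
    (hB : ∀ w ∈ slitSquareBoundary a h, ‖G w‖ ≤ B) : ‖slitSquareIntegral a h G‖ ≤ 8 * a * B := by
  have ha : 0 < a := h0.trans_le hha
  have n1 := abs_of_pos ha
  have n2 := abs_neg_self_of_pos ha
  have hB0 : 0 ≤ B := (norm_nonneg _).trans (hB _ (horizontal_mem_slitSquareBoundary hha n1
    (right_mem_Icc.2 (by linarith))))
  have b1 : ∀ {s : ℝ}, |s| = a → ‖∫ x : ℝ in -a..a, G (x + s * Complex.I)‖ ≤ B * (2 * a) := by
    intro s hs
    refine (intervalIntegral.norm_integral_le_of_norm_le_const fun x hx => hB _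
      (horizontal_mem_slitSquareBoundary hha hs ?_)).trans (le_of_eq ?_)
    · rw [uIoc_of_le (by linarith)] at hx
      exact Ioc_subset_Icc_self hx
    · rw [abs_of_pos (by linarith)]
      ring
  have b2 : ∀ {s : ℝ}, |s| = a → ‖∫ y : ℝ in h..a, G (s + y * Complex.I)‖ ≤ B * a := by
    intro s hs
    refine (intervalIntegral.norm_integral_le_of_norm_le_const (C := B) fun x hx => ?_).trans ?_
    · rw [uIoc_of_le hha] at hx
      have := upper_mem h0 (Ioc_subset_Icc_self hx)
      exact hB _ (vertical_mem_slitSquareBoundary hs this.1 this.2)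
    · rw [abs_of_nonneg (by linarith)]
      gcongr
      linarith
  have b3 : ∀ {s : ℝ}, |s| = a → ‖∫ y : ℝ in (-a)..(-h), G (s + y * Complex.I)‖ ≤ B * a := by
    intro s hs
    refine (intervalIntegral.norm_integral_le_of_norm_le_const (C := B) fun x hx => ?_).trans ?_
    · rw [uIoc_of_le (by linarith)] at hx
      have := lower_mem h0 (Ioc_subset_Icc_self hx)
      exact hB _ (vertical_mem_slitSquareBoundary hs this.1 this.2)
    · rw [abs_of_nonneg (by linarith)]
      gcongr
      linarith
  have hI : ∀ z : ℂ, ‖Complex.I * z‖ = ‖z‖ := fun z => by simp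
  rw [slitSquareIntegral]
  refine (norm_sub_le_of_le (norm_add_le_of_le (norm_sub_le_of_le (norm_add_le_of_le
    (norm_sub_le_of_le (b1 n2) (b1 n1)) ((hI _).le.trans (b2 n1))) ((hI _).le.trans (b2 n2)))
    ((hI _).le.trans (b3 n1))) ((hI _).le.trans (b3 n2))).trans (le_of_eq ?_)
  ring

theorem le_im_integral {f : ℝ → ℂ} {α β k : ℝ} (hαβ : α ≤ β) (hf : ContinuousOn f (Icc α β))
    (hk : ∀ x ∈ Icc α β, k ≤ (f x).im) : k * (β - α) ≤ (∫ x in α..β, f x).im := by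
  have h1 := Complex.imCLM.intervalIntegral_comp_comm
    (hf.intervalIntegrable_of_Icc (μ := volume) hαβ)
  simp only [Complex.imCLM_apply] at h1
  rw [← h1]
  have h2 : k * (β - α) = ∫ _ in α..β, k := by simp [mul_comm]
  rw [h2]
  refine intervalIntegral.integral_mono_on hαβ (by simp) ?_ hk
  exact (Complex.continuous_im.comp_continuousOn hf).intervalIntegrable_of_Icc hαβ

theorem half_le_norm_sub {w w₀ : ℂ} (hw : |w.re| = a ∨ |w.im| = a)
    (hre : |w₀.re| ≤ a / 2) (him : |w₀.im| ≤ a / 2) : a / 2 ≤ ‖w - w₀‖ := by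
  rcases hw with h | h
  · refine le_trans ?_ (Complex.abs_re_le_norm _)
    rw [Complex.sub_re]
    have := abs_sub_abs_le_abs_sub w.re w₀.re
    linarith
  · refine le_trans ?_ (Complex.abs_im_le_norm _)
    rw [Complex.sub_im]
    have := abs_sub_abs_le_abs_sub w.im w₀.im
    linarith

theorem continuousOn_inv_sub (ha : 0 < a) {w₀ : ℂ} (hre : |w₀.re| ≤ a / 2)
    (him : |w₀.im| ≤ a / 2) :
    ContinuousOn (fun w => (w - w₀)⁻¹) (slitSquareBoundary a h) := by
  refine ContinuousOn.inv₀ (by fun_prop) fun w hw h1 => ?_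
  have := half_le_norm_sub hw.2.2.2 hre him
  rw [h1, norm_zero] at this
  linarith

/-- All sides of a square contribute positively to the imaginary part of the integral of
`1 / (w - w₀)`; the lower side alone contributes at least `1 / 4`. -/
theorem quarter_le_norm_slitSquareIntegral_inv_sub (h0 : 0 < h) (hha : h ≤ a) {w₀ : ℂ}
    (hre : |w₀.re| ≤ a / 2) (him : |w₀.im| ≤ a / 2) (him0 : 0 ≤ w₀.im) :
    1 / 4 ≤ ‖slitSquareIntegral a h fun w => (w - w₀)⁻¹‖ := by
  have ha : 0 < a := h0.trans_le hha
  have n1 := abs_of_pos ha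
  have n2 := abs_neg_self_of_pos ha
  have hc := continuousOn_inv_sub (h := h) ha hre him
  have r1 := abs_le.1 hre
  have r2 := abs_le.1 him
  have hinv : ∀ w : ℂ, ((w - w₀)⁻¹).im = -(w.im - w₀.im) / Complex.normSq (w - w₀) := fun w => by
    rw [Complex.inv_im, Complex.sub_im]
  have hinv' : ∀ w : ℂ, (Complex.I * (w - w₀)⁻¹).im =
      (w.re - w₀.re) / Complex.normSq (w - w₀) := fun w => by
    rw [Complex.I_mul_im, Complex.inv_re, Complex.sub_re]
  have hinv'' : ∀ w : ℂ, (-(Complex.I * (w - w₀)⁻¹)).im =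
      -(w.re - w₀.re) / Complex.normSq (w - w₀) := fun w => by
    rw [Complex.neg_im, hinv', neg_div]
  have s1 : 1 / (8 * a) * (a - -a) ≤
      (∫ x : ℝ in -a..a, ((x : ℂ) + (-a : ℝ) * Complex.I - w₀)⁻¹).im := by
    refine le_im_integral (by linarith) (continuousOn_horizontal hha hc n2) fun x hx => ?_
    have hpos : 0 < Complex.normSq ((x : ℂ) + (-a : ℝ) * Complex.I - w₀) := by
      rw [Complex.normSq_eq_norm_sq]
      have := half_le_norm_sub (w := (x : ℂ) + (-a : ℝ) * Complex.I) (by simp [n1]) hre him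
      have h2 : 0 < a / 2 := by linarith
      exact pow_pos (h2.trans_le this) 2
    rw [hinv, le_div_iff₀ hpos, Complex.normSq_apply]
    simp only [Complex.add_re, Complex.add_im, Complex.sub_re, Complex.sub_im, Complex.mul_re,
      Complex.mul_im, Complex.ofReal_re, Complex.ofReal_im, Complex.I_re, Complex.I_im, mul_zero,
      mul_one, sub_zero, add_zero, zero_add]
    rw [div_mul_eq_mul_div, div_le_iff₀ (by linarith), one_mul]
    have q1 : (x - w₀.re) * (x - w₀.re) ≤ 4 * a ^ 2 := by nlinarith [hx.1, hx.2]
    have q2 : (-a - w₀.im) * (-a - w₀.im) ≤ 4 * a ^ 2 := by nlinarith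
    nlinarith
  have s2 : 0 * (a - -a) ≤ (∫ x : ℝ in -a..a, -((x : ℂ) + a * Complex.I - w₀)⁻¹).im := by
    refine le_im_integral (by linarith) (continuousOn_horizontal hha hc n1).neg fun x hx => ?_
    rw [Complex.neg_im, hinv, neg_div, neg_neg]
    refine div_nonneg ?_ (Complex.normSq_nonneg _)
    simp
    linarith
  have s3 : 0 * (a - h) ≤
      (∫ y : ℝ in h..a, Complex.I * ((a : ℂ) + y * Complex.I - w₀)⁻¹).im := by
    refine le_im_integral hha ((continuousOn_upper h0 hc n1).const_mul _) fun x hx => ?_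
    rw [hinv']
    refine div_nonneg ?_ (Complex.normSq_nonneg _)
    simp
    linarith
  have s4 : 0 * (a - h) ≤
      (∫ y : ℝ in h..a, -(Complex.I * (((-a : ℝ) : ℂ) + y * Complex.I - w₀)⁻¹)).im := by
    refine le_im_integral hha ((continuousOn_upper h0 hc n2).const_mul _).neg fun x hx => ?_
    rw [hinv'']
    refine div_nonneg ?_ (Complex.normSq_nonneg _)
    simp
    linarith
  have s5 : 0 * (-h - -a) ≤
      (∫ y : ℝ in (-a)..(-h), Complex.I * ((a : ℂ) + y * Complex.I - w₀)⁻¹).im := by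
    refine le_im_integral (by linarith) ((continuousOn_lower h0 hc n1).const_mul _)
      fun x hx => ?_
    rw [hinv']
    refine div_nonneg ?_ (Complex.normSq_nonneg _)
    simp
    linarith
  have s6 : 0 * (-h - -a) ≤
      (∫ y : ℝ in (-a)..(-h), -(Complex.I * (((-a : ℝ) : ℂ) + y * Complex.I - w₀)⁻¹)).im := by
    refine le_im_integral (by linarith) ((continuousOn_lower h0 hc n2).const_mul _).neg
      fun x hx => ?_
    rw [hinv'']
    refine div_nonneg ?_ (Complex.normSq_nonneg _)
    simp
    linarith
  have e1 : 1 / (8 * a) * (a - -a) = 1 / 4 := by field_simp; norm_num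
  simp only [intervalIntegral.integral_neg, intervalIntegral.integral_const_mul, Complex.neg_im,
    zero_mul] at s2 s3 s4 s5 s6
  rw [e1] at s1
  refine le_trans ?_ ((le_abs_self _).trans (Complex.abs_im_le_norm _))
  simp only [slitSquareIntegral, Complex.add_im, Complex.sub_im]
  linarith

end SlitSquare

section SlitSquareCauchy

variable {A a M : ℝ} {F : ℂ → ℂ}

theorem isOpen_slitSquare (A : ℝ) : IsOpen (slitSquare A) := by
  have h1 : IsOpen {w : ℂ | |w.re| < A} := isOpen_lt (by fun_prop) continuous_const
  have h2 : IsOpen {w : ℂ | |w.im| < A} := isOpen_lt (by fun_prop) continuous_const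
  have h3 : IsOpen {w : ℂ | w.im ≠ 0} := isOpen_ne_fun (by fun_prop) continuous_const
  exact h1.inter (h2.inter h3)

theorem rect_subset_slitSquare {h s : ℝ} (haA : a < A) (hs : uIcc h s ⊆ {y | |y| ≤ a ∧ y ≠ 0}) :
    uIcc (-a) a ×ℂ uIcc h s ⊆ slitSquare A ∩ {w | w.im ∈ uIcc h s} := by
  intro w hw
  rw [Complex.mem_reProdIm] at hw
  have h2 := hs hw.2
  refine ⟨⟨?_, h2.1.trans_lt haA, h2.2⟩, hw.2⟩
  refine lt_of_le_of_lt ?_ haA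
  have h3 : 0 ≤ a := (abs_nonneg _).trans h2.1
  have h4 := hw.1
  rw [uIcc_of_le (by linarith)] at h4
  exact abs_le.2 h4

/-- Cauchy's theorem in the upper and the lower half of a square: what is missing from the integral
along the boundary is the pair of integrals along the horizontal segments at height `±h`. -/
theorem slitSquareIntegral_slope (haA : a < A) (hF : DifferentiableOn ℂ F (slitSquare A))
    {w₀ : ℂ} (hw₀ : w₀ ∈ slitSquare A) (hre : |w₀.re| ≤ a / 2) (him : |w₀.im| ≤ a / 2)
    (him0 : 0 < w₀.im) {h : ℝ} (h0 : 0 < h) (hha : h < w₀.im) :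
    slitSquareIntegral a h (fun w => (w - w₀)⁻¹ * (F w - F w₀)) =
      (∫ x : ℝ in -a..a, ((x : ℂ) + (-h : ℝ) * Complex.I - w₀)⁻¹ *
        (F (x + (-h : ℝ) * Complex.I) - F w₀)) -
      ∫ x : ℝ in -a..a, ((x : ℂ) + h * Complex.I - w₀)⁻¹ * (F (x + h * Complex.I) - F w₀) := by
  have hia := abs_le.1 him
  have ha : 0 < a := by linarith
  have hha' : h ≤ a := by linarith
  have n1 := abs_of_pos ha
  have n2 := abs_neg_self_of_pos ha
  have hd : DifferentiableOn ℂ (dslope F w₀) (slitSquare A) :=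
    (Complex.differentiableOn_dslope ((isOpen_slitSquare A).mem_nhds hw₀)).2 hF
  have hds : ∀ w : ℂ, w ≠ w₀ → dslope F w₀ w = (w - w₀)⁻¹ * (F w - F w₀) := fun w hw => by
    rw [dslope_of_ne _ hw, slope_def_field, div_eq_inv_mul]
  have hbd : ∀ w : ℂ, (|w.re| = a ∨ |w.im| = a ∨ |w.im| = h) →
      dslope F w₀ w = (w - w₀)⁻¹ * (F w - F w₀) := by
    intro w hw
    refine hds w ?_
    rintro rfl
    rcases hw with h1 | h1 | h1
    · linarith
    · linarith
    · rw [abs_of_pos him0] at h1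
      linarith
  have hup := Complex.integral_boundary_rect_eq_zero_of_differentiableOn (dslope F w₀)
    ⟨-a, h⟩ ⟨a, a⟩ (hd.mono ((rect_subset_slitSquare haA (by
      rw [uIcc_of_le hha']
      intro y hy
      exact ⟨(upper_mem h0 hy).1, (h0.trans_le hy.1).ne'⟩)).trans inter_subset_left))
  have hlow := Complex.integral_boundary_rect_eq_zero_of_differentiableOn (dslope F w₀)
    ⟨-a, -a⟩ ⟨a, -h⟩ (hd.mono ((rect_subset_slitSquare haA (by
      rw [uIcc_of_le (by linarith)]
      intro y hy
      exact ⟨(lower_mem h0 hy).1, by linarith [hy.2]⟩)).trans inter_subset_left))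
  simp only [smul_eq_mul] at hup hlow
  have e1 : ∀ s : ℝ, (|s| = a ∨ |s| = h) → ∫ x : ℝ in -a..a, dslope F w₀ (x + s * Complex.I) =
      ∫ x : ℝ in -a..a, ((x : ℂ) + s * Complex.I - w₀)⁻¹ * (F (x + s * Complex.I) - F w₀) := by
    intro s hs
    refine intervalIntegral.integral_congr fun x _ => hbd _ (Or.inr ?_)
    simpa using hs
  have e2 : ∀ s α β : ℝ, |s| = a → ∫ y : ℝ in α..β, dslope F w₀ (s + y * Complex.I) =
      ∫ y : ℝ in α..β, ((s : ℂ) + y * Complex.I - w₀)⁻¹ * (F (s + y * Complex.I) - F w₀) := by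
    intro s α β hs
    refine intervalIntegral.integral_congr fun x _ => hbd _ (Or.inl ?_)
    simpa using hs
  rw [e1 _ (Or.inr (abs_of_pos h0)), e1 _ (Or.inl n1), e2 _ _ _ n1, e2 _ _ _ n2] at hup
  rw [e1 (-h) (Or.inr (by rw [abs_neg, abs_of_pos h0])), e1 (-a) (Or.inl n2), e2 _ _ _ n1,
    e2 _ _ _ n2] at hlow
  simp only [slitSquareIntegral]
  linear_combination hup + hlow

/-- If the boundary values of `F` on the two sides of the real axis agree almost everywhere, the
integral of the difference quotient along the boundary of a square vanishes in the limit. -/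
theorem tendsto_slitSquareIntegral_slope (haA : a < A) (hF : DifferentiableOn ℂ F (slitSquare A))
    (hM : ∀ w ∈ slitSquare A, ‖F w‖ ≤ M)
    (hlim : ∀ᵐ x : ℝ, |x| < A → ∃ l, Tendsto (fun h : ℝ => F (x + h * Complex.I)) (𝓝[>] 0) (𝓝 l) ∧
      Tendsto (fun h : ℝ => F (x + (-h : ℝ) * Complex.I)) (𝓝[>] 0) (𝓝 l))
    {w₀ : ℂ} (hre : |w₀.re| ≤ a / 2) (him : |w₀.im| ≤ a / 2) (him0 : 0 < w₀.im) :
    Tendsto (fun h => slitSquareIntegral a h (fun w => (w - w₀)⁻¹ * (F w - F w₀))) (𝓝[>] 0)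
      (𝓝 0) := by
  have hia := abs_le.1 him
  have ha : 0 < a := by linarith
  have hw₀ : w₀ ∈ slitSquare A := ⟨by linarith, by linarith, him0.ne'⟩
  set D : ℝ → ℝ → ℂ := fun h x => ((x : ℂ) + (-h : ℝ) * Complex.I - w₀)⁻¹ *
        (F (x + (-h : ℝ) * Complex.I) - F w₀) -
      ((x : ℂ) + h * Complex.I - w₀)⁻¹ * (F (x + h * Complex.I) - F w₀) with hD
  -- points at height at most half that of `w₀` keep a definite distance from it
  have hdist : ∀ x h : ℝ, |h| ≤ w₀.im / 2 → w₀.im / 2 ≤ ‖(x : ℂ) + h * Complex.I - w₀‖ := by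
    intro x h hh
    refine le_trans ?_ (Complex.abs_im_le_norm _)
    have h1 : ((x : ℂ) + h * Complex.I - w₀).im = h - w₀.im := by simp
    rw [h1, abs_sub_comm]
    refine le_trans ?_ (le_abs_self _)
    linarith [(abs_le.1 hh).2]
  have hmem : ∀ x h : ℝ, x ∈ Icc (-a) a → |h| ≤ w₀.im / 2 → h ≠ 0 →
      (x : ℂ) + h * Complex.I ∈ slitSquare A := by
    intro x h hx hh hne
    refine ⟨?_, ?_, ?_⟩
    · simpa using (abs_le.2 hx).trans_lt haA
    · simp only [Complex.add_im, Complex.ofReal_im, Complex.mul_im, Complex.ofReal_re,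
        Complex.I_im, mul_one, Complex.I_re, mul_zero, add_zero, zero_add]
      linarith
    · simpa using hne
  have hcont : ∀ h : ℝ, |h| ≤ w₀.im / 2 → h ≠ 0 → ContinuousOn (fun x : ℝ =>
      ((x : ℂ) + h * Complex.I - w₀)⁻¹ * (F (x + h * Complex.I) - F w₀)) (Icc (-a) a) := by
    intro h hh hne
    refine ContinuousOn.mul (ContinuousOn.inv₀ (by fun_prop) fun x _ h1 => ?_) ?_
    · have := hdist x h hh
      rw [h1, norm_zero] at this
      linarith
    · refine ContinuousOn.sub (hF.continuousOn.comp (by fun_prop) fun x hx => ?_)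
        continuousOn_const
      exact hmem x h hx hh hne
  have hbound : ∀ x h : ℝ, x ∈ Icc (-a) a → |h| ≤ w₀.im / 2 → h ≠ 0 →
      ‖((x : ℂ) + h * Complex.I - w₀)⁻¹ * (F (x + h * Complex.I) - F w₀)‖ ≤
        (w₀.im / 2)⁻¹ * (M + M) := by
    intro x h hx hh hne
    rw [norm_mul, norm_inv]
    have h1 := hdist x h hh
    refine mul_le_mul (inv_anti₀ (by linarith) h1) ?_ (norm_nonneg _) (by positivity)
    exact norm_sub_le_of_le (hM _ (hmem x h hx hh hne)) (hM _ hw₀)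
  have hsmall : ∀ᶠ h : ℝ in 𝓝[>] 0, 0 < h ∧ h ≤ w₀.im / 2 := by
    filter_upwards [Ioo_mem_nhdsGT (show (0 : ℝ) < w₀.im / 2 by linarith)] with h hh
    exact ⟨hh.1, hh.2.le⟩
  have hle : -a ≤ a := by linarith
  have hT : Tendsto (fun h => ∫ x in -a..a, D h x) (𝓝[>] 0) (𝓝 (∫ _ in -a..a, (0 : ℂ))) := by
    refine intervalIntegral.tendsto_integral_filter_of_dominated_convergence
      (fun _ => (w₀.im / 2)⁻¹ * (M + M) + (w₀.im / 2)⁻¹ * (M + M)) ?_ ?_ (by simp) ?_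
    · filter_upwards [hsmall] with h hh
      rw [uIoc_of_le hle]
      refine (ContinuousOn.aestronglyMeasurable (ContinuousOn.sub (hcont (-h) ?_ ?_)
        (hcont h ?_ ?_)) measurableSet_Icc).mono_set Ioc_subset_Icc_self
      · rw [abs_neg, abs_of_pos hh.1]; exact hh.2
      · exact neg_ne_zero.2 hh.1.ne'
      · rw [abs_of_pos hh.1]; exact hh.2
      · exact hh.1.ne'
    · filter_upwards [hsmall] with h hh
      refine Eventually.of_forall fun x hx => ?_
      rw [uIoc_of_le hle] at hx
      have hx' := Ioc_subset_Icc_self hx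
      refine norm_sub_le_of_le (hbound x (-h) hx' ?_ ?_) (hbound x h hx' ?_ ?_)
      · rw [abs_neg, abs_of_pos hh.1]; exact hh.2
      · exact neg_ne_zero.2 hh.1.ne'
      · rw [abs_of_pos hh.1]; exact hh.2
      · exact hh.1.ne'
    · filter_upwards [hlim] with x hx hxa
      rw [uIoc_of_le hle] at hxa
      obtain ⟨l, h1, h2⟩ := hx ((abs_le.2 (Ioc_subset_Icc_self hxa)).trans_lt haA)
      have hne : (x : ℂ) + (0 : ℝ) * Complex.I - w₀ ≠ 0 := by
        intro h3
        have := hdist x 0 (by rw [abs_zero]; linarith)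
        rw [h3, norm_zero] at this
        linarith
      have k1 : Tendsto (fun h : ℝ => ((x : ℂ) + h * Complex.I - w₀)⁻¹) (𝓝[>] 0)
          (𝓝 ((x : ℂ) + (0 : ℝ) * Complex.I - w₀)⁻¹) := by
        have : Continuous fun h : ℝ => (x : ℂ) + h * Complex.I - w₀ := by fun_prop
        exact ((this.tendsto 0).mono_left nhdsWithin_le_nhds).inv₀ hne
      have k2 : Tendsto (fun h : ℝ => ((x : ℂ) + (-h : ℝ) * Complex.I - w₀)⁻¹) (𝓝[>] 0)
          (𝓝 ((x : ℂ) + (-0 : ℝ) * Complex.I - w₀)⁻¹) := by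
        have : Continuous fun h : ℝ => (x : ℂ) + (-h : ℝ) * Complex.I - w₀ := by fun_prop
        exact ((this.tendsto 0).mono_left nhdsWithin_le_nhds).inv₀ (by rwa [neg_zero])
      rw [neg_zero] at k2
      have k3 := (k2.mul (h2.sub_const (F w₀))).sub (k1.mul (h1.sub_const (F w₀)))
      rwa [sub_self] at k3
  rw [intervalIntegral.integral_zero] at hT
  refine hT.congr' ?_
  filter_upwards [hsmall] with h hh
  rw [slitSquareIntegral_slope haA hF hw₀ hre him him0 hh.1 (by linarith)]
  refine intervalIntegral.integral_sub
    ((hcont (-h) ?_ ?_).intervalIntegrable_of_Icc hle)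
    ((hcont h ?_ ?_).intervalIntegrable_of_Icc hle)
  · rw [abs_neg, abs_of_pos hh.1]; exact hh.2
  · exact neg_ne_zero.2 hh.1.ne'
  · rw [abs_of_pos hh.1]; exact hh.2
  · exact hh.1.ne'

/-- A bounded function, analytic off the real axis, whose boundary values on the two sides of the
axis agree almost everywhere, continues analytically across the axis. The lemma records the
consequence that it satisfies a Lipschitz condition near the axis. -/
theorem norm_sub_le_of_boundaryValues_agree (haA : a < A)
    (hF : DifferentiableOn ℂ F (slitSquare A)) (hM : ∀ w ∈ slitSquare A, ‖F w‖ ≤ M)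
    (hlim : ∀ᵐ x : ℝ, |x| < A → ∃ l, Tendsto (fun h : ℝ => F (x + h * Complex.I)) (𝓝[>] 0) (𝓝 l) ∧
      Tendsto (fun h : ℝ => F (x + (-h : ℝ) * Complex.I)) (𝓝[>] 0) (𝓝 l))
    {w₀ w₁ : ℂ} (hre : |w₀.re| ≤ a / 2) (him : |w₀.im| ≤ a / 2) (him0 : 0 < w₀.im)
    (hre1 : |w₁.re| ≤ a / 2) (him1 : |w₁.im| ≤ a / 2) (him01 : 0 < w₁.im) :
    ‖F w₀ - F w₁‖ ≤ 256 * M / a * ‖w₀ - w₁‖ := by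
  have hia := abs_le.1 him
  have ha : 0 < a := by linarith
  have hw₁ : w₁ ∈ slitSquare A := ⟨by linarith, by linarith, him01.ne'⟩
  have t0 := (tendsto_slitSquareIntegral_slope haA hF hM hlim hre him him0).norm
  have t1 := (tendsto_slitSquareIntegral_slope haA hF hM hlim hre1 him1 him01).norm
  have t2 := ((t0.add t1).const_mul 4).add_const (256 * M / a * ‖w₀ - w₁‖)
  simp only [norm_zero, add_zero, mul_zero, zero_add] at t2
  refine ge_of_tendsto t2 ?_
  filter_upwards [Ioo_mem_nhdsGT ha] with h hh
  have hsub : slitSquareBoundary a h ⊆ slitSquare A := by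
    intro w hw
    refine ⟨hw.1.trans_lt haA, hw.2.1.trans_lt haA, fun h1 => ?_⟩
    have := hw.2.2.1
    rw [h1, abs_zero] at this
    linarith [hh.1]
  have hFc : ContinuousOn F (slitSquareBoundary a h) := hF.continuousOn.mono hsub
  have c0 := continuousOn_inv_sub (h := h) ha hre him
  have c1 := continuousOn_inv_sub (h := h) ha hre1 him1
  set S := slitSquareIntegral a h with hS
  set R : ℂ → ℂ := fun w => (F w - F w₁) * ((w - w₀)⁻¹ - (w - w₁)⁻¹) with hR
  -- subtracting the two Cauchy integrals leaves `F w₁ - F w₀` times the integral of `1 / (w - w₀)`,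
  -- of which only a lower bound is needed, and the Cauchy kernels' difference, of order `w₀ - w₁`
  have key : (F w₁ - F w₀) * S (fun w => (w - w₀)⁻¹) =
      S (fun w => (w - w₀)⁻¹ * (F w - F w₀)) + (-1) * S (fun w => (w - w₁)⁻¹ * (F w - F w₁)) +
        (-1) * S R := by
    rw [hS, ← slitSquareIntegral_const_mul, ← slitSquareIntegral_const_mul,
      ← slitSquareIntegral_const_mul, ← slitSquareIntegral_add hh.1 hh.2.le,
      ← slitSquareIntegral_add hh.1 hh.2.le]
    · congr 1
      funext w
      simp only [hR]
      ring
    · fun_prop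
    · fun_prop
    · fun_prop
    · fun_prop
  have hRb : ‖S R‖ ≤ 8 * a * (2 * M * (‖w₀ - w₁‖ / (a / 2) ^ 2)) := by
    refine norm_slitSquareIntegral_le hh.1 hh.2.le fun w hw => ?_
    have d0 := half_le_norm_sub hw.2.2.2 hre him
    have d1 := half_le_norm_sub hw.2.2.2 hre1 him1
    have ha2 : 0 < a / 2 := by linarith
    have n0 : w - w₀ ≠ 0 := norm_pos_iff.1 (ha2.trans_le d0)
    have n1 : w - w₁ ≠ 0 := norm_pos_iff.1 (ha2.trans_le d1)
    have e : (w - w₀)⁻¹ - (w - w₁)⁻¹ = (w₀ - w₁) / ((w - w₀) * (w - w₁)) := by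
      field_simp
      ring
    rw [hR, norm_mul, e, norm_div, norm_mul]
    refine mul_le_mul ?_ ?_ (by positivity) ?_
    · rw [two_mul]
      exact norm_sub_le_of_le (hM _ (hsub hw)) (hM _ hw₁)
    · rw [sq]
      gcongr
    · linarith [(norm_nonneg _).trans (hM _ hw₁)]
  have hN : 1 / 4 ≤ ‖S fun w => (w - w₀)⁻¹‖ :=
    quarter_le_norm_slitSquareIntegral_inv_sub hh.1 hh.2.le hre him him0.le
  have h5 : ‖F w₀ - F w₁‖ * (1 / 4) ≤ ‖S (fun w => (w - w₀)⁻¹ * (F w - F w₀))‖ +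
      ‖S (fun w => (w - w₁)⁻¹ * (F w - F w₁))‖ + ‖S R‖ := by
    calc ‖F w₀ - F w₁‖ * (1 / 4) ≤ ‖F w₁ - F w₀‖ * ‖S fun w => (w - w₀)⁻¹‖ := by
          rw [norm_sub_rev]
          gcongr
      _ = ‖S (fun w => (w - w₀)⁻¹ * (F w - F w₀)) +
          (-1) * S (fun w => (w - w₁)⁻¹ * (F w - F w₁)) + (-1) * S R‖ := by
          rw [← norm_mul, key]
      _ ≤ _ := by
          refine (norm_add₃_le).trans (le_of_eq ?_)
          simp
  have h6 : 256 * M / a * ‖w₀ - w₁‖ = 4 * (8 * a * (2 * M * (‖w₀ - w₁‖ / (a / 2) ^ 2))) := by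
    field_simp
    ring
  rw [h6]
  linarith

end SlitSquareCauchy

/-! ### Inner functions near points outside the spectrum -/

theorem exists_le_norm_of_notMem_innerSpectrum {I : ℂ → ℂ} {ζ : ℂ} (hζ : ζ ∈ closedBall (0 : ℂ) 1)
    (h : ζ ∉ innerSpectrum I) :
    ∃ c > 0, ∃ ε > 0, ∀ z ∈ unitDisc, z ∈ ball ζ ε → c ≤ ‖I z‖ := by
  have h1 : liminf (fun z => ‖I z‖ₑ) (𝓝[unitDisc] ζ) ≠ 0 := fun h2 => h ⟨hζ, h2⟩
  obtain ⟨c, hc0, hc⟩ := ENNReal.lt_iff_exists_nnreal_btwn.1 (pos_iff_ne_zero.2 h1)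
  have h3 := eventually_lt_of_lt_liminf hc
  rw [eventually_nhdsWithin_iff, Metric.eventually_nhds_iff_ball] at h3
  obtain ⟨ε, hε, h4⟩ := h3
  refine ⟨c, by exact_mod_cast hc0, ε, hε, fun z hz hzε => ?_⟩
  have h5 := (h4 z hzε hz).le
  rw [enorm_eq_nnnorm] at h5
  exact_mod_cast h5

theorem exp_mul_I_mem_unitDisc {w : ℂ} (hw : 0 < w.im) :
    Complex.exp (w * Complex.I) ∈ unitDisc := by
  rw [unitDisc, mem_ball, dist_zero_right, Complex.norm_exp]
  simpa using hw

theorem exp_real_add_mul_I (x h : ℝ) :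
    Complex.exp (((x : ℂ) + h * Complex.I) * Complex.I) =
      (Real.exp (-h) : ℂ) * circleMap 0 1 x := by
  rw [circleMap, Complex.ofReal_exp, zero_add, Complex.ofReal_one, one_mul, ← Complex.exp_add]
  congr 1
  push_cast
  linear_combination (h : ℂ) * Complex.I_sq

theorem tendsto_exp_neg_nhdsLT_one : Tendsto (fun h : ℝ => Real.exp (-h)) (𝓝[>] 0) (𝓝[<] 1) := by
  refine tendsto_nhdsWithin_iff.2 ⟨?_, ?_⟩
  · have : Tendsto (fun h : ℝ => Real.exp (-h)) (𝓝 0) (𝓝 (Real.exp (-0))) :=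
      (by fun_prop : Continuous fun h : ℝ => Real.exp (-h)).tendsto 0
    rw [neg_zero, Real.exp_zero] at this
    exact this.mono_left nhdsWithin_le_nhds
  · filter_upwards [self_mem_nhdsWithin] with h hh
    rw [mem_Iio, Real.exp_lt_one_iff, neg_lt_zero]
    exact hh

/-- In the coordinate `w`, with `z = exp (i (θ + w))`, an inner function that is bounded away from
zero near `exp (i θ)` satisfies a Lipschitz condition near the origin. Its continuation to the
lower half plane is the reflection `w ↦ 1 / conj (I (exp (i (θ + conj w))))`. -/
theorem exists_lipschitz_exp {I : ℂ → ℂ} (hI : IsInnerFunction I) (θ : ℝ)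
    (hθ : circleMap 0 1 θ ∉ innerSpectrum I) :
    ∃ b > 0, ∃ C, ∀ w₀ w₁ : ℂ, |w₀.re| ≤ b → |w₀.im| ≤ b → 0 < w₀.im →
      |w₁.re| ≤ b → |w₁.im| ≤ b → 0 < w₁.im →
      ‖I (Complex.exp ((θ + w₀) * Complex.I)) - I (Complex.exp ((θ + w₁) * Complex.I))‖ ≤
        C * ‖w₀ - w₁‖ := by
  obtain ⟨hId, ⟨M, hM⟩, hIb⟩ := hI
  obtain ⟨c, hc, ε, hε, hcε⟩ := exists_le_norm_of_notMem_innerSpectrum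
    (by simp : circleMap 0 1 θ ∈ closedBall (0 : ℂ) 1) hθ
  have hMc : Continuous fun w : ℂ => Complex.exp ((θ + w) * Complex.I) := by fun_prop
  have h0 : Complex.exp ((θ + 0) * Complex.I) = circleMap 0 1 θ := by simp [circleMap]
  obtain ⟨d, hd, hdε⟩ := Metric.continuousAt_iff.1 (hMc.continuousAt (x := 0)) ε hε
  rw [h0] at hdε
  set A : ℝ := d / 2 with hA
  have hA0 : 0 < A := by positivity
  have hball : ∀ w : ℂ, |w.re| < A → |w.im| < A →
      Complex.exp ((θ + w) * Complex.I) ∈ ball (circleMap 0 1 θ) ε := by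
    intro w h1 h2
    refine hdε ?_
    rw [dist_zero_right]
    linarith [Complex.norm_le_abs_re_add_abs_im w]
  set J : ℂ → ℂ := fun w => I (Complex.exp ((θ + w) * Complex.I)) with hJ
  have hmem : ∀ w : ℂ, 0 < w.im → Complex.exp ((θ + w) * Complex.I) ∈ unitDisc := fun w hw =>
    exp_mul_I_mem_unitDisc (by simpa using hw)
  have hJd : ∀ w : ℂ, 0 < w.im → DifferentiableAt ℂ J w := by
    intro w hw
    have h1 : DifferentiableAt ℂ I (Complex.exp ((θ + w) * Complex.I)) :=
      hId.differentiableAt (isOpen_ball.mem_nhds (hmem w hw))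
    have h2 : DifferentiableAt ℂ (fun w : ℂ => Complex.exp ((θ + w) * Complex.I)) w := by fun_prop
    exact h1.comp w h2
  have hJc : ∀ w : ℂ, |w.re| < A → |w.im| < A → 0 < w.im → c ≤ ‖J w‖ := fun w h1 h2 h3 =>
    hcε _ (hmem w h3) (hball w h1 h2)
  set F : ℂ → ℂ := fun w =>
    if 0 < w.im then J w else (starRingEnd ℂ) ((J ((starRingEnd ℂ) w))⁻¹) with hF
  have hFup : ∀ w : ℂ, 0 < w.im → F w = J w := fun w hw => if_pos hw
  have hFlow : ∀ w : ℂ, w.im < 0 → F w = (starRingEnd ℂ) ((J ((starRingEnd ℂ) w))⁻¹) :=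
    fun w hw => if_neg hw.not_gt
  have hFd : DifferentiableOn ℂ F (slitSquare A) := by
    intro w hw
    refine DifferentiableAt.differentiableWithinAt ?_
    rcases lt_or_gt_of_ne hw.2.2 with h | h
    · have h1 : 0 < ((starRingEnd ℂ) w).im := by rw [Complex.conj_im]; linarith
      have h2 : J ((starRingEnd ℂ) w) ≠ 0 := by
        refine norm_pos_iff.1 (hc.trans_le (hJc _ ?_ ?_ h1))
        · rw [Complex.conj_re]; exact hw.1
        · rw [Complex.conj_im, abs_neg]; exact hw.2.1
      have h3 : DifferentiableAt ℂ (fun w => (J w)⁻¹) ((starRingEnd ℂ) w) :=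
        (hJd _ h1).inv h2
      have h4 := h3.conj_conj
      rw [Complex.conj_conj] at h4
      refine h4.congr_of_eventuallyEq ?_
      filter_upwards [(isOpen_lt Complex.continuous_im continuous_const).mem_nhds h] with v hv
      exact hFlow v hv
    · refine (hJd w h).congr_of_eventuallyEq ?_
      filter_upwards [(isOpen_lt continuous_const Complex.continuous_im).mem_nhds h] with v hv
      exact hFup v hv
  have hFM : ∀ w ∈ slitSquare A, ‖F w‖ ≤ max M c⁻¹ := by
    intro w hw
    rcases lt_or_gt_of_ne hw.2.2 with h | h
    · have h1 : 0 < ((starRingEnd ℂ) w).im := by rw [Complex.conj_im]; linarith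
      rw [hFlow w h, RCLike.norm_conj, norm_inv]
      refine le_trans (inv_anti₀ hc (hJc _ ?_ ?_ h1)) (le_max_right _ _)
      · rw [Complex.conj_re]; exact hw.1
      · rw [Complex.conj_im, abs_neg]; exact hw.2.1
    · rw [hFup w h]
      exact (hM _ (hmem w h)).trans (le_max_left _ _)
  have hlim : ∀ᵐ x : ℝ, |x| < A → ∃ l,
      Tendsto (fun h : ℝ => F (x + h * Complex.I)) (𝓝[>] 0) (𝓝 l) ∧
      Tendsto (fun h : ℝ => F (x + (-h : ℝ) * Complex.I)) (𝓝[>] 0) (𝓝 l) := by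
    filter_upwards [(measurePreserving_add_left volume θ).quasiMeasurePreserving.ae hIb]
      with x ⟨l, hl, hl1⟩ _
    have hJl : Tendsto (fun h : ℝ => J (x + h * Complex.I)) (𝓝[>] 0) (𝓝 l) := by
      have hl' : Tendsto (fun r : ℝ => I ((r : ℂ) * circleMap 0 1 (θ + x))) (𝓝[<] 1) (𝓝 l) := hl
      refine (hl'.comp tendsto_exp_neg_nhdsLT_one).congr fun h => ?_
      simp only [Function.comp_apply, hJ]
      rw [← exp_real_add_mul_I, Complex.ofReal_add, add_assoc]
    refine ⟨l, hJl.congr' ?_, ?_⟩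
    · filter_upwards [self_mem_nhdsWithin] with h hh
      exact (hFup _ (by simpa using hh)).symm
    · have hl0 : l ≠ 0 := norm_pos_iff.1 (by rw [hl1]; exact one_pos)
      have h1 := (Complex.continuous_conj.tendsto _).comp (hJl.inv₀ hl0)
      -- the reflected boundary value is the same because it is unimodular
      have h2 : (starRingEnd ℂ) l⁻¹ = l := by
        rw [Complex.inv_def, Complex.normSq_eq_norm_sq, hl1]
        simp
      rw [h2] at h1
      refine h1.congr' ?_
      filter_upwards [self_mem_nhdsWithin] with h hh
      have hh0 : (0 : ℝ) < h := hh
      rw [hFlow _ (by simpa using hh0), Function.comp_apply]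
      congr 3
      simp
  refine ⟨A / 2 / 2, by positivity, 256 * max M c⁻¹ / (A / 2), fun w₀ w₁ h1 h2 h3 h4 h5 h6 => ?_⟩
  have := norm_sub_le_of_boundaryValues_agree (by linarith : A / 2 < A) hFd hFM hlim
    h1 h2 h3 h4 h5 h6
  rwa [hFup _ h3, hFup _ h6] at this

theorem norm_log_sub_log_le {u v : ℂ} (hu : u ∈ ball (1 : ℂ) (1 / 2))
    (hv : v ∈ ball (1 : ℂ) (1 / 2)) : ‖Complex.log u - Complex.log v‖ ≤ 2 * ‖u - v‖ := by
  refine (convex_ball (1 : ℂ) (1 / 2)).norm_image_sub_le_of_norm_hasDerivWithin_le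
    (f' := fun x => x⁻¹) (fun x hx => ?_) (fun x hx => ?_) hv hu
  · exact (Complex.hasDerivAt_log
      (Complex.ball_one_subset_slitPlane (ball_subset_ball (by norm_num) hx))).hasDerivWithinAt
  · have h1 : (1 : ℝ) / 2 ≤ ‖x‖ := by
      rw [mem_ball, dist_eq_norm] at hx
      have := norm_sub_norm_le (1 : ℂ) (1 - x)
      rw [sub_sub_cancel, norm_one, norm_sub_rev] at this
      linarith
    rw [norm_inv]
    calc ‖x‖⁻¹ ≤ (1 / 2)⁻¹ := inv_anti₀ (by norm_num) h1
      _ = 2 := by norm_num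

/-- An inner function satisfies a Lipschitz condition in the disc near every point of the circle
that is not in its spectrum. -/
theorem exists_lipschitz_near {I : ℂ → ℂ} (hI : IsInnerFunction I) (θ : ℝ)
    (hθ : circleMap 0 1 θ ∉ innerSpectrum I) :
    ∃ η > 0, ∃ C, ∀ z ∈ unitDisc, z ∈ ball (circleMap 0 1 θ) η →
      ∀ z' ∈ unitDisc, z' ∈ ball (circleMap 0 1 θ) η → ‖I z - I z'‖ ≤ C * ‖z - z'‖ := by
  obtain ⟨b, hb, C, hC⟩ := exists_lipschitz_exp hI θ hθ
  set ζ := circleMap 0 1 θ with hζ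
  have hζ1 : ‖ζ‖ = 1 := norm_circleMap_zero_one θ
  have hζ0 : ζ ≠ 0 := norm_pos_iff.1 (by rw [hζ1]; exact one_pos)
  have hdiv : ∀ z z' : ℂ, ‖z / ζ - z' / ζ‖ = ‖z - z'‖ := fun z z' => by
    rw [← sub_div, norm_div, hζ1, div_one]
  set W : ℂ → ℂ := fun z => -Complex.I * Complex.log (z / ζ) with hW
  have hone : (1 : ℂ) ∈ ball (1 : ℂ) (1 / 2) := mem_ball_self (by norm_num)
  have hball : ∀ z ∈ ball ζ (min (1 / 2) (b / 2)), z / ζ ∈ ball (1 : ℂ) (1 / 2) ∧ ‖W z‖ ≤ b := by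
    intro z hz
    rw [mem_ball, dist_eq_norm, lt_min_iff] at hz
    have h1 : ‖z / ζ - 1‖ = ‖z - ζ‖ := by rw [← div_self hζ0, hdiv]
    have h2 : z / ζ ∈ ball (1 : ℂ) (1 / 2) := by
      rw [mem_ball, dist_eq_norm, h1]
      exact hz.1
    refine ⟨h2, ?_⟩
    have h3 := norm_log_sub_log_le h2 hone
    rw [Complex.log_one, sub_zero, h1] at h3
    simp only [hW, norm_mul, norm_neg, Complex.norm_I, one_mul]
    linarith
  have hexp : ∀ z ∈ unitDisc, z ∈ ball ζ (min (1 / 2) (b / 2)) →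
      Complex.exp ((θ + W z) * Complex.I) = z ∧ 0 < (W z).im := by
    intro z hz hzb
    have hz0 : z / ζ ≠ 0 := by
      intro h
      have := (hball z hzb).1
      rw [h] at this
      norm_num at this
    have h1 : ((θ : ℂ) + W z) * Complex.I = θ * Complex.I + Complex.log (z / ζ) := by
      simp only [hW]
      linear_combination (-Complex.log (z / ζ)) * Complex.I_sq
    refine ⟨?_, ?_⟩
    · rw [h1, Complex.exp_add, Complex.exp_log hz0]
      have : ζ = Complex.exp (θ * Complex.I) := by simp [hζ, circleMap]
      rw [← this]
      field_simp
    · have h2 : (W z).im = -Real.log ‖z‖ := by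
        simp [hW, Complex.log_re, hζ1]
      rw [h2, neg_pos]
      refine Real.log_neg ?_ (norm_lt_one_of_mem_unitDisc hz)
      rw [norm_pos_iff]
      rintro rfl
      simp at hz0
  refine ⟨min (1 / 2) (b / 2), by positivity, max C 0 * 2, fun z hz hzb z' hz' hzb' => ?_⟩
  have h1 := hC (W z) (W z') ((Complex.abs_re_le_norm _).trans (hball z hzb).2)
    ((Complex.abs_im_le_norm _).trans (hball z hzb).2) (hexp z hz hzb).2
    ((Complex.abs_re_le_norm _).trans (hball z' hzb').2)
    ((Complex.abs_im_le_norm _).trans (hball z' hzb').2) (hexp z' hz' hzb').2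
  rw [(hexp z hz hzb).1, (hexp z' hz' hzb').1] at h1
  refine h1.trans ?_
  have h2 : ‖W z - W z'‖ ≤ 2 * ‖z - z'‖ := by
    have h3 := norm_log_sub_log_le (hball z hzb).1 (hball z' hzb').1
    rw [hdiv] at h3
    simp only [hW]
    rwa [← mul_sub, norm_mul, norm_neg, Complex.norm_I, one_mul]
  calc C * ‖W z - W z'‖ ≤ max C 0 * (2 * ‖z - z'‖) :=
        mul_le_mul (le_max_left _ _) h2 (norm_nonneg _) (le_max_right _ _)
    _ = max C 0 * 2 * ‖z - z'‖ := by ring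

/-- Near a point outside the spectrum, an inner function differs from its boundary values, taken
anywhere on the circle, by at most a multiple of the distance. -/
theorem exists_norm_radialLimit_sub_le {I : ℂ → ℂ} (hI : IsInnerFunction I) (θ : ℝ)
    (hθ : circleMap 0 1 θ ∉ innerSpectrum I) :
    ∃ η > 0, ∃ C, 0 ≤ C ∧ ∀ z ∈ unitDisc, z ∈ ball (circleMap 0 1 θ) η →
      ∀ (t : ℝ) (b : ℂ), HasRadialLimit I (circleMap 0 1 t) b →
        ‖b - I z‖ ≤ C * ‖circleMap 0 1 t - z‖ := by
  obtain ⟨η, hη, C, hC⟩ := exists_lipschitz_near hI θ hθ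
  obtain ⟨-, ⟨M, hM⟩, -⟩ := hI
  have hM0 : 0 ≤ M := (norm_nonneg _).trans (hM 0 (by simp [unitDisc]))
  refine ⟨η / 2, by positivity, max C (4 * M / η), le_max_of_le_right (by positivity),
    fun z hz hzη t b hb => ?_⟩
  have hbt : Tendsto (fun r : ℝ => I ((r : ℂ) * circleMap 0 1 t)) (𝓝[<] 1) (𝓝 b) := hb
  have hmem := eventually_real_mul_circleMap_mem t
  by_cases hnear : circleMap 0 1 t ∈ ball (circleMap 0 1 θ) η
  · have h1 := tendsto_real_mul (circleMap 0 1 t)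
    have h4 := (h1.sub_const z).norm.const_mul C
    refine le_trans (le_of_tendsto_of_tendsto (hbt.sub_const (I z)).norm h4 ?_) ?_
    · filter_upwards [hmem, h1.eventually (isOpen_ball.mem_nhds hnear)] with r hr1 hr2
      exact hC _ hr1 hr2 z hz (ball_subset_ball (by linarith) hzη)
    · gcongr
      exact le_max_left _ _
  · have h5 : η / 2 ≤ ‖circleMap 0 1 t - z‖ := by
      rw [mem_ball, dist_eq_norm] at hnear hzη
      have := norm_sub_le_norm_sub_add_norm_sub (circleMap 0 1 t) z (circleMap 0 1 θ)
      linarith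
    have h6 : ‖b‖ ≤ M := le_of_tendsto hbt.norm (by
      filter_upwards [hmem] with r hr using hM _ hr)
    calc ‖b - I z‖ ≤ M + M := norm_sub_le_of_le h6 (hM z hz)
      _ = 4 * M / η * (η / 2) := by field_simp; ring
      _ ≤ max C (4 * M / η) * ‖circleMap 0 1 t - z‖ := by
        gcongr
        exact le_max_right _ _

/-! ### Boundedness of pseudocontinuable functions off the spectrum -/

theorem integrable_boundaryValue {r : ℝ} (hr : 1 < r) {f : ℂ → ℂ} (hf : f ∈ hardySpace r)
    (hlim : ∀ᵐ t : ℝ, ∃ w, HasRadialLimit f (circleMap 0 1 t) w) :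
    Integrable (fun t => boundaryValue f (circleMap 0 1 t)) circleProb := by
  have hr0 : 0 < r := by linarith
  have hm := aestronglyMeasurable_boundaryValue hf.1 hlim
  have h1 : MemLp (fun t => boundaryValue f (circleMap 0 1 t)) (ENNReal.ofReal r) circleProb := by
    refine ⟨hm, ?_⟩
    rw [eLpNorm_lt_top_iff_lintegral_rpow_enorm_lt_top (by simpa using hr0) ENNReal.ofReal_ne_top,
      ENNReal.toReal_ofReal hr0.le]
    exact (lintegral_boundaryValue_lt_top hr0.le hf hlim).lt_top
  exact h1.integrable (by simpa using ENNReal.ofReal_le_ofReal hr.le)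

/-- If `f = I * conj ψ` on the circle with `ψ 0 = 0`, then
`f z = ∫ ζ / (ζ - z) * (I ζ - I z) * conj (ψ ζ)`, since the Cauchy integral of `conj ψ` vanishes.
Where `I` satisfies a Lipschitz condition this bounds `f` by the mean of `|ψ|`. -/
theorem exists_bound_near {r : ℝ} (hr : 1 < r) {f I ψ : ℂ → ℂ} (hI : IsInnerFunction I)
    (hf : f ∈ hardySpace r) (hψ : ψ ∈ hardySpace r) (hψ0 : ψ 0 = 0) (hfac : BoundaryFactor f I ψ)
    (θ : ℝ) (hθ : circleMap 0 1 θ ∉ innerSpectrum I) :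
    ∃ η > 0, ∃ B, ∀ z ∈ unitDisc, z ∈ ball (circleMap 0 1 θ) η → ‖f z‖ ≤ B := by
  obtain ⟨η, hη, C, hC0, hC⟩ := exists_norm_radialLimit_sub_le hI θ hθ
  have hflim : ∀ᵐ t : ℝ, ∃ w, HasRadialLimit f (circleMap 0 1 t) w :=
    hfac.mono fun t ⟨a, _, _, ha, _⟩ => ⟨a, ha⟩
  have hψlim : ∀ᵐ t : ℝ, ∃ w, HasRadialLimit ψ (circleMap 0 1 t) w :=
    hfac.mono fun t ⟨_, _, w, _, _, hw, _⟩ => ⟨w, hw⟩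
  have hfi := integrable_boundaryValue hr hf hflim
  have hψi := integrable_boundaryValue hr hψ hψlim
  refine ⟨η, hη, ∫ t, C * ‖boundaryValue ψ (circleMap 0 1 t)‖ ∂circleProb, fun z hz hzη => ?_⟩
  have hk := continuous_cauchyKernel hz
  have hkb := norm_cauchyKernel_le hz
  have hψc : Integrable (fun t => (starRingEnd ℂ) (boundaryValue ψ (circleMap 0 1 t)))
      circleProb := by
    refine hψi.norm.mono' (Complex.continuous_conj.comp_aestronglyMeasurable hψi.1)
      (Eventually.of_forall fun t => ?_)
    rw [RCLike.norm_conj]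
  have h1 := hfi.bdd_mul hk.aestronglyMeasurable (Eventually.of_forall hkb)
  have h2 := (hψc.bdd_mul hk.aestronglyMeasurable (Eventually.of_forall hkb)).const_mul (I z)
  have h3 : f z = ∫ t, (circleMap 0 1 t / (circleMap 0 1 t - z) *
        boundaryValue f (circleMap 0 1 t) -
      I z * (circleMap 0 1 t / (circleMap 0 1 t - z) *
        (starRingEnd ℂ) (boundaryValue ψ (circleMap 0 1 t)))) ∂circleProb := by
    rw [integral_sub h1 h2, integral_const_mul, integral_cauchy_boundaryValue hr hf hflim hz,
      integral_cauchy_conj_boundaryValue hr hψ hψlim hz, hψ0]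
    simp
  rw [h3]
  refine norm_integral_le_of_norm_le (hψi.norm.const_mul C) ?_
  filter_upwards [ae_circleProb hfac] with t ⟨a, b, w, ha, hb, hw, hab⟩
  have hpos : 0 < ‖circleMap 0 1 t - z‖ := norm_pos_iff.2 (circleMap_sub_ne_zero hz t)
  have h4 := hC z hz hzη t b hb
  rw [ha.boundaryValue_eq, hw.boundaryValue_eq, hab]
  have h5 : circleMap 0 1 t / (circleMap 0 1 t - z) * (b * (starRingEnd ℂ) w) -
      I z * (circleMap 0 1 t / (circleMap 0 1 t - z) * (starRingEnd ℂ) w) =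
      circleMap 0 1 t / (circleMap 0 1 t - z) * (b - I z) * (starRingEnd ℂ) w := by ring
  rw [h5, norm_mul, norm_mul, norm_div, norm_circleMap_zero_one, RCLike.norm_conj]
  gcongr
  rw [one_div_mul_eq_div, div_le_iff₀ hpos]
  exact h4

theorem IsClosedArc.isCompact {Γ : Set ℂ} (hΓ : IsClosedArc Γ) : IsCompact Γ := by
  obtain ⟨a, b, -, rfl⟩ := hΓ
  exact isCompact_Icc.image (continuous_circleMap 0 1)

theorem exists_bound_on_arc {r : ℝ} (hr : 1 < r) {f I ψ : ℂ → ℂ} (hI : IsInnerFunction I)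
    (hf : f ∈ hardySpace r) (hψ : ψ ∈ hardySpace r) (hψ0 : ψ 0 = 0) (hfac : BoundaryFactor f I ψ)
    {Γ : Set ℂ} (hΓ : IsClosedArc Γ) (hΓI : Disjoint Γ (innerSpectrum I)) :
    ∃ B : ℝ, ∀ t : ℝ, circleMap 0 1 t ∈ Γ → ∀ a, HasRadialLimit f (circleMap 0 1 t) a →
      ‖a‖ ≤ B := by
  have key : ∃ B : ℝ, ∀ ζ ∈ Γ, ∀ t : ℝ, circleMap 0 1 t = ζ → ∀ a,
      HasRadialLimit f (circleMap 0 1 t) a → ‖a‖ ≤ B := by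
    refine hΓ.isCompact.induction_on (p := fun S => ∃ B : ℝ, ∀ ζ ∈ S, ∀ t : ℝ,
      circleMap 0 1 t = ζ → ∀ a, HasRadialLimit f (circleMap 0 1 t) a → ‖a‖ ≤ B) ?_ ?_ ?_ ?_
    · exact ⟨0, fun ζ hζ => absurd hζ (notMem_empty ζ)⟩
    · rintro S T hST ⟨B, hB⟩
      exact ⟨B, fun ζ hζ => hB ζ (hST hζ)⟩
    · rintro S T ⟨B, hB⟩ ⟨B', hB'⟩
      refine ⟨max B B', fun ζ hζ t ht a ha => ?_⟩
      rcases hζ with hζ | hζ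
      · exact (hB ζ hζ t ht a ha).trans (le_max_left _ _)
      · exact (hB' ζ hζ t ht a ha).trans (le_max_right _ _)
    · intro ζ₀ hζ₀
      obtain ⟨θ, rfl⟩ : ∃ θ : ℝ, circleMap 0 1 θ = ζ₀ := by
        obtain ⟨a, b, -, rfl⟩ := hΓ
        obtain ⟨θ, -, hθ⟩ := hζ₀
        exact ⟨θ, hθ⟩
      obtain ⟨η, hη, B, hB⟩ := exists_bound_near hr hI hf hψ hψ0 hfac θ
        (disjoint_left.1 hΓI hζ₀)
      refine ⟨ball (circleMap 0 1 θ) η, mem_nhdsWithin_of_mem_nhds (ball_mem_nhds _ hη), B,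
        fun ζ hζ t ht a ha => ?_⟩
      have ha' : Tendsto (fun r : ℝ => f ((r : ℂ) * circleMap 0 1 t)) (𝓝[<] 1) (𝓝 a) := ha
      refine le_of_tendsto ha'.norm ?_
      filter_upwards [eventually_real_mul_circleMap_mem t,
        (tendsto_real_mul (circleMap 0 1 t)).eventually (isOpen_ball.mem_nhds (ht.symm ▸ hζ))]
        with r hr1 hr2
      exact hB _ hr1 hr2
  obtain ⟨B, hB⟩ := key
  exact ⟨B, fun t ht a ha => hB _ ht t rfl a ha⟩

/-! ### Weighted Hardy spaces -/

/-- By Hölder's inequality, `H^p(|g|^p)` lies in `H^r`, `1/r = 1/p + 1/s`, if `1/g` is in `H^s`. -/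
theorem mem_hardySpace_of_mem_weighted {p s r : ℝ} (hp : 0 < p) (hs : 0 < s)
    (hr : r = (1 / p + 1 / s)⁻¹) {f g : ℂ → ℂ} (hg : DifferentiableOn ℂ g unitDisc)
    (hg0 : ∀ z ∈ unitDisc, g z ≠ 0) {K : ENNReal} (hK : K ≠ ⊤)
    (hgK : ∀ ρ : ℝ, 0 < ρ → ρ < 1 → ∫⁻ t, ‖(g (circleMap 0 ρ t))⁻¹‖ₑ ^ s ∂circleProb ≤ K)
    (hf : f ∈ weightedHardySpace p g) : f ∈ hardySpace r := by
  have hr0 : 0 < r := by rw [hr]; positivity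
  have hrp : r < p := by
    rw [hr, inv_lt_comm₀ (by positivity) hp, ← one_div]
    have : 0 < 1 / s := by positivity
    linarith
  have hrr : 1 / r = 1 / p + 1 / s := by rw [hr, one_div, inv_inv]
  obtain ⟨hd, A, hA, hb⟩ := (mem_hardySpace_iff hp.le).1 (mul_mem_hardySpace_of_mem_weighted hg hf)
  refine (mem_hardySpace_iff hr0.le).2 ⟨hf.1, (A ^ (1 / p) * K ^ (1 / s)) ^ r, ?_,
    fun ρ h0 h1 => ?_⟩
  · refine ENNReal.rpow_ne_top_of_nonneg hr0.le (ENNReal.mul_ne_top ?_ ?_)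
    · exact ENNReal.rpow_ne_top_of_nonneg (by positivity) hA
    · exact ENNReal.rpow_ne_top_of_nonneg (by positivity) hK
  · have hgc := continuous_comp_circleMap hg.continuousOn h0 h1
    have hfc := continuous_comp_circleMap hf.1.continuousOn h0 h1
    have h2 := ENNReal.lintegral_Lp_mul_le_Lq_mul_Lr hr0 hrp hrr circleProb
      (f := fun t => ‖f (circleMap 0 ρ t) * g (circleMap 0 ρ t)‖ₑ)
      (g := fun t => ‖(g (circleMap 0 ρ t))⁻¹‖ₑ) (hfc.mul hgc).measurable.enorm.aemeasurable
      hgc.measurable.inv.enorm.aemeasurable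
    have h3 : ∀ t, ((fun t => ‖f (circleMap 0 ρ t) * g (circleMap 0 ρ t)‖ₑ) *
        fun t => ‖(g (circleMap 0 ρ t))⁻¹‖ₑ) t = ‖f (circleMap 0 ρ t)‖ₑ := fun t => by
      rw [Pi.mul_apply, ← enorm_mul,
        mul_inv_cancel_right₀ (hg0 _ (circleMap_mem_unitDisc h0 h1 t))]
    simp_rw [h3] at h2
    have h4 := ENNReal.rpow_le_rpow h2 hr0.le
    rw [← ENNReal.rpow_mul, one_div_mul_cancel hr0.ne', ENNReal.rpow_one] at h4
    refine h4.trans (ENNReal.rpow_le_rpow ?_ hr0.le)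
    gcongr
    · exact hb ρ h0 h1
    · exact hgK ρ h0 h1

theorem mem_weightedHardySpace_of_bounded {p : ℝ} (hp : 0 ≤ p) {f g : ℂ → ℂ}
    (hg : DifferentiableOn ℂ g unitDisc) {M : ℝ} (hM : ∀ z ∈ unitDisc, ‖g z‖ ≤ M)
    (hf : f ∈ hardySpace p) : f ∈ weightedHardySpace p g := by
  obtain ⟨hfd, C, hC⟩ := hf
  have hM0 : 0 ≤ M := (norm_nonneg _).trans (hM 0 (by simp [unitDisc]))
  refine ⟨hfd, M ^ p * C, fun r h0 h1 => ?_⟩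
  have hfc := (continuous_comp_circleMap hfd.continuousOn h0 h1).norm.rpow_const
    (fun _ => Or.inr hp)
  have hgc := (continuous_comp_circleMap hg.continuousOn h0 h1).norm.rpow_const
    (fun _ => Or.inr hp)
  refine le_trans ?_ (mul_le_mul_of_nonneg_left (hC r h0 h1) (by positivity))
  rw [circleAverage_eq_integral_circleProb, circleAverage_eq_integral_circleProb,
    ← integral_const_mul]
  refine integral_mono (integrable_circleProb_of_continuous (hfc.mul hgc))
    ((integrable_circleProb_of_continuous hfc).const_mul _) fun t => ?_
  simp only
  rw [mul_comm]
  gcongr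
  exact hM _ (circleMap_mem_unitDisc h0 h1 t)

/-- The boundary values of a function in `H^p(|g|^p)` are in `L^p` if they are bounded on `Γ` and
`|g|` is bounded below off `Γ`. -/
theorem lintegral_boundaryValue_ne_top_of_weighted {p δ B : ℝ} (hp : 0 ≤ p) (hδ : 0 < δ)
    {Γ : Set ℂ} {f g : ℂ → ℂ} (hg : DifferentiableOn ℂ g unitDisc)
    (hglim : ∀ᵐ t : ℝ, ∃ w, HasRadialLimit g (circleMap 0 1 t) w)
    (hgδ : ∀ᵐ t : ℝ, circleMap 0 1 t ∉ Γ → δ ≤ ‖boundaryValue g (circleMap 0 1 t)‖)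
    (hf : f ∈ weightedHardySpace p g)
    (hflim : ∀ᵐ t : ℝ, ∃ w, HasRadialLimit f (circleMap 0 1 t) w)
    (hB : ∀ᵐ t : ℝ, circleMap 0 1 t ∈ Γ → ‖boundaryValue f (circleMap 0 1 t)‖ ≤ B) :
    ∫⁻ t, ‖boundaryValue f (circleMap 0 1 t)‖ₑ ^ p ∂circleProb ≠ ⊤ := by
  have hfg := mul_mem_hardySpace_of_mem_weighted hg hf
  have hprod : ∀ᵐ t : ℝ, HasRadialLimit (fun z => f z * g z) (circleMap 0 1 t)
      (boundaryValue f (circleMap 0 1 t) * boundaryValue g (circleMap 0 1 t)) := by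
    filter_upwards [hflim, hglim] with t ⟨a, ha⟩ ⟨b, hb⟩
    exact Tendsto.mul ha.hasRadialLimit_boundaryValue hb.hasRadialLimit_boundaryValue
  have hfin := lintegral_boundaryValue_lt_top hp hfg (hprod.mono fun t ht => ⟨_, ht⟩)
  have hle : ∫⁻ t, ‖boundaryValue f (circleMap 0 1 t)‖ₑ ^ p ∂circleProb ≤
      ∫⁻ t, (ENNReal.ofReal B ^ p + ENNReal.ofReal δ⁻¹ ^ p *
        ‖boundaryValue (fun z => f z * g z) (circleMap 0 1 t)‖ₑ ^ p) ∂circleProb := by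
    refine lintegral_mono_ae ?_
    filter_upwards [ae_circleProb hprod, ae_circleProb hgδ, ae_circleProb hB] with t h1 h2 h3
    by_cases ht : circleMap 0 1 t ∈ Γ
    · refine le_trans ?_ le_self_add
      gcongr
      rw [← ofReal_norm]
      exact ENNReal.ofReal_le_ofReal (h3 ht)
    · refine le_trans ?_ le_add_self
      rw [← ENNReal.mul_rpow_of_nonneg _ _ hp]
      gcongr
      rw [h1.boundaryValue_eq, ← ofReal_norm, ← ofReal_norm,
        ← ENNReal.ofReal_mul (inv_nonneg.2 hδ.le), norm_mul]
      refine ENNReal.ofReal_le_ofReal ?_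
      rw [inv_mul_eq_div, le_div_iff₀ hδ]
      gcongr
      exact h2 ht
  refine ne_top_of_le_ne_top ?_ hle
  rw [lintegral_add_left measurable_const, lintegral_const, measure_univ, mul_one,
    lintegral_const_mul' _ _ (ENNReal.rpow_ne_top_of_nonneg hp ENNReal.ofReal_ne_top)]
  exact ENNReal.add_ne_top.2 ⟨ENNReal.rpow_ne_top_of_nonneg hp ENNReal.ofReal_ne_top,
    ENNReal.mul_ne_top (ENNReal.rpow_ne_top_of_nonneg hp ENNReal.ofReal_ne_top) hfin⟩

theorem lintegral_inv_rpow_ne_top {u : ℝ → ℂ} {Γ : Set ℂ} (hΓ : IsClosedArc Γ) {δ : ℝ}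
    (hδ : 0 < δ) (hu : ∀ᵐ t : ℝ, circleMap 0 1 t ∉ Γ → δ ≤ ‖u t‖) {s : ℝ} (hs : 0 < s)
    (hint : MemLp (fun t => (u t)⁻¹) (ENNReal.ofReal s)
      (volume.restrict (Ioc 0 (2 * Real.pi) ∩ circleMap 0 1 ⁻¹' Γ))) :
    ∫⁻ t, ‖(u t)⁻¹‖ₑ ^ s ∂circleProb ≠ ⊤ := by
  have h1 := hint.2
  rw [eLpNorm_lt_top_iff_lintegral_rpow_enorm_lt_top (by simpa using hs) ENNReal.ofReal_ne_top,
    ENNReal.toReal_ofReal hs.le] at h1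
  have hm : MeasurableSet (circleMap 0 1 ⁻¹' Γ) :=
    hΓ.isCompact.isClosed.measurableSet.preimage (continuous_circleMap 0 1).measurable
  have h2 : ∫⁻ t in Ioc 0 (2 * Real.pi) \ circleMap 0 1 ⁻¹' Γ, ‖(u t)⁻¹‖ₑ ^ s ≤
      ∫⁻ _ in Ioc 0 (2 * Real.pi), ENNReal.ofReal δ⁻¹ ^ s := by
    refine le_trans ?_ (lintegral_mono_set (s := Ioc 0 (2 * Real.pi) \ circleMap 0 1 ⁻¹' Γ)
      sdiff_subset)
    refine setLIntegral_mono_ae' (measurableSet_Ioc.diff hm) ?_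
    filter_upwards [hu] with t ht htΓ
    gcongr
    rw [← ofReal_norm, norm_inv]
    exact ENNReal.ofReal_le_ofReal (inv_anti₀ hδ (ht htΓ.2))
  rw [circleProb, lintegral_smul_measure, smul_eq_mul, ← lintegral_inter_add_sdiff _ _ hm]
  refine ENNReal.mul_ne_top (ENNReal.inv_ne_top.2 (by simp [Real.pi_pos]))
    (ENNReal.add_ne_top.2 ⟨h1.ne, ne_top_of_le_ne_top ?_ h2⟩)
  rw [setLIntegral_const]
  exact ENNReal.mul_ne_top (ENNReal.rpow_ne_top_of_nonneg hs.le ENNReal.ofReal_ne_top)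
    measure_Ioc_lt_top.ne

/-! ### The weighted and the unweighted model space -/

theorem corollary2 (p q : ℝ) (hp : 1 < p) (hpq : 1 / p + 1 / q = 1)
    (I : ℂ → ℂ) (hI : IsInnerFunction I)
    (Γ : Set ℂ) (hΓ : IsClosedArc Γ) (hΓI : Disjoint Γ (innerSpectrum I))
    (g : ℂ → ℂ) (hg : IsOuterFunction g) (hgp : g ∈ hardySpace p)
    (δ : ℝ) (hδ : 0 < δ)
    (hgδ : ∀ᵐ t : ℝ, circleMap 0 1 t ∉ Γ → δ ≤ ‖boundaryValue g (circleMap 0 1 t)‖)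
    (s : ENNReal) (hs : ENNReal.ofReal q < s)
    (hgs : MemLpOnArc (fun ζ => (boundaryValue g ζ)⁻¹) s Γ) :
    weightedModelSpace p I g ⊆ modelSpace p I ∧
      ((∃ M : ℝ, ∀ z ∈ unitDisc, ‖g z‖ ≤ M) →
        weightedModelSpace p I g = modelSpace p I) := by
  have hp0 : 0 < p := by linarith
  have hq0 : 0 < q := by
    have h1 : 1 / p < 1 := by rw [div_lt_one hp0]; exact hp
    exact one_div_pos.1 (by linarith)
  have hgd := hgp.1
  -- a finite exponent `s'` with `q < s' ≤ s`
  obtain ⟨s', hqs', hs's⟩ := ENNReal.lt_iff_exists_nnreal_btwn.1 hs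
  have hqs : q < s' := by
    rwa [ENNReal.ofReal, ENNReal.coe_lt_coe, Real.toNNReal_lt_iff_lt_coe hq0.le] at hqs'
  have hs0 : (0 : ℝ) < s' := hq0.trans hqs
  have hs'e : ENNReal.ofReal s' = s' := ENNReal.ofReal_coe_nnreal
  obtain ⟨c, φ, hc, hφ0, hφ, hgφ⟩ := hg
  have hgb := ae_hasRadialLimit_outer hc hφ0 hφ hgφ hp.le hgp
  have hg0 : ∀ z ∈ unitDisc, g z ≠ 0 := fun z hz => by
    rw [← norm_pos_iff, norm_eq_exp_integral_poissonMeasure hc hφ hgφ hz]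
    exact Real.exp_pos _
  have hinv : ∫⁻ t, ENNReal.ofReal ((φ (circleMap 0 1 t)) ^ (-(s' : ℝ))) ∂circleProb ≠ ⊤ := by
    have h1 := lintegral_inv_rpow_ne_top hΓ hδ hgδ hs0
      (u := fun t => boundaryValue g (circleMap 0 1 t))
      (by
        rw [hs'e]
        have : IsFiniteMeasure
            (volume.restrict (Ioc 0 (2 * Real.pi) ∩ circleMap 0 1 ⁻¹' Γ)) := by
          refine ⟨?_⟩
          rw [Measure.restrict_apply_univ]
          exact (measure_mono inter_subset_left).trans_lt measure_Ioc_lt_top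
        exact MemLp.mono_exponent hgs hs's.le)
    rw [← lintegral_congr_ae] at h1
    · exact h1
    · filter_upwards [ae_circleProb hgb] with t ht
      rw [← ofReal_norm_rpow _ hs0.le, norm_inv, ht.2, Real.inv_rpow (hφ0 _).le,
        Real.rpow_neg (hφ0 _).le]
  set r : ℝ := (1 / p + 1 / (s' : ℝ))⁻¹ with hr
  have hr1 : 1 < r := by
    have h1 : 1 / (s' : ℝ) < 1 / q := one_div_lt_one_div_of_lt hq0 hqs
    exact (one_lt_inv₀ (by positivity)).2 (by linarith)
  have hw : ∀ f ∈ weightedHardySpace p g, f ∈ hardySpace r := fun f hf =>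
    mem_hardySpace_of_mem_weighted hp0 hs0 hr hgd hg0 hinv
      (fun ρ h0 h1 => lintegral_inv_outer_le hc hφ0 hφ hgφ hs0 hinv h0 h1) hf
  have hsub : weightedModelSpace p I g ⊆ modelSpace p I := by
    rintro f ⟨hf, ψ, hψ, hψ0, hfac⟩
    have hfr := hw f hf
    have hψr := hw ψ hψ
    have hflim : ∀ᵐ t : ℝ, ∃ w, HasRadialLimit f (circleMap 0 1 t) w :=
      hfac.mono fun t ⟨a, _, _, ha, _⟩ => ⟨a, ha⟩
    have hψlim : ∀ᵐ t : ℝ, ∃ w, HasRadialLimit ψ (circleMap 0 1 t) w :=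
      hfac.mono fun t ⟨_, _, w, _, _, hw, _⟩ => ⟨w, hw⟩
    obtain ⟨B, hB⟩ := exists_bound_on_arc hr1 hI hfr hψr hψ0 hfac hΓ hΓI
    have hfin := lintegral_boundaryValue_ne_top_of_weighted hp0.le hδ hgd
      (hgb.mono fun t ht => ⟨_, ht.1⟩) hgδ hf hflim (B := B) (by
        filter_upwards [hflim] with t ⟨a, ha⟩ ht
        exact hB t ht _ ha.hasRadialLimit_boundaryValue)
    have hψfin : ∫⁻ t, ‖boundaryValue ψ (circleMap 0 1 t)‖ₑ ^ p ∂circleProb ≠ ⊤ := by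
      -- `|ψ| = |f|` almost everywhere on the circle
      rw [lintegral_congr_ae] at hfin
      · exact hfin
      · filter_upwards [ae_circleProb hfac, ae_circleProb hI.2.2] with t
          ⟨a, b, w, ha, hb, hw, hab⟩ ⟨b', hb', hb1⟩
        have hbb : b = b' := by rw [← hb.boundaryValue_eq, hb'.boundaryValue_eq]
        have h1 : ‖a‖ₑ = ‖w‖ₑ := by
          rw [← ofReal_norm, ← ofReal_norm, hab, norm_mul, hbb, hb1, one_mul, RCLike.norm_conj]
        rw [ha.boundaryValue_eq, hw.boundaryValue_eq, h1]
    exact ⟨mem_hardySpace_of_lintegral_boundaryValue hr1 hp.le hfr hflim hfin, ψ,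
      mem_hardySpace_of_lintegral_boundaryValue hr1 hp.le hψr hψlim hψfin, hψ0, hfac⟩
  refine ⟨hsub, fun ⟨M, hM⟩ => hsub.antisymm ?_⟩
  rintro f ⟨hf, ψ, hψ, hψ0, hfac⟩
  exact ⟨mem_weightedHardySpace_of_bounded hp0.le hgd hM hf, ψ,
    mem_weightedHardySpace_of_bounded hp0.le hgd hM hψ, hψ0, hfac⟩
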